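/- Let $n\in\mathbb N$, let $(\Omega,\mathcal F,\mathbb P)$ be a probability space, and let $(\tau_k)_{k\in\mathbb Z}$ be an ergodic group of measure preserving transformations of it: $\tau_0=\mathrm{id}$, $\tau_{k+k'}=\tau_k\circ\tau_{k'}$, each $\tau_k$ is measurable and preserves $\mathbb P$, and every $U\in\mathcal F$ with $\tau_k(U)=U$ for all $k\in\mathbb Z$ has $\mathbb P[U]\in\{0,1\}$. Let $a:\mathbb R^n\times\mathbb R\times\Omega\to\mathbb R$ satisfy assumption (A): (A0) $a$ is measurable with respect to $\mathcal B(\mathbb R^{n+1})\otimes\mathcal F$; (A1) $a(x+l,t,\tau_k\omega)=a(x,t+k,\omega)$ for all $x\in\mathbb R^n$, $l\in\mathbb Z^n$, $t\in\mathbb R$, $k\in\mathbb Z$, $\omega\in\Omega$; (A2) $a(\cdot,\cdot,\omega)$ is Lipschitz continuous on $\mathbb R^{n+1}$ for each $\omega\in\Omega$, and there are $\alpha,\beta>0$ with $\alpha\le a(x,t,\omega)\le\beta$ for all $(x,t)\in\mathbb R^{n+1}$ and $\omega\in\Omega$. For $t\ge 0$, $x\in\mathbb R^n$ and $\omega\in\Omega$,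 let $\mathcal R_t(x)(\omega)$ be the set of all $y\in\mathbb R^n$ for which there is an absolutely continuous path $\gamma:[0,t]\to\mathbb R^n$ with $\gamma(0)=x$, $\gamma(t)=y$ and $|\gamma'(r)|\le a(\gamma(r),r,\omega)$ for a.e. $r\in[0,t]$. Let $Y=[0,1]^n$, let $\mathscr C$ be the set of non-empty compact subsets of $\mathbb R^n$, and let $\rho$ be the Hausdorff metric on $\mathscr C$ (with respect to the Euclidean norm). Then there exist a non-empty compact convex set $D\subset\mathbb R^n$ (not depending on $\omega$) and an event $\widetilde\Omega\in\mathcal F$ with $\mathbb P[\widetilde\Omega]=1$ such that, for every $\omega\in\widetilde\Omega$ and every $x\in Y$, the sets $\mathcal R_t(x)(\omega)$, $t>0$, belong to $\mathscr C$ and $$\lim_{t\to\infty}\frac{\mathcal R_t(x)(\omega)}{t}=D\quad\text{in }(\mathscr C,\rho),$$ and, moreover, for every $\omega\in\widetilde\Omega$, $$\lim_{t\to\infty}\ \sup_{x\in Y}\rho\left(\frac{\mathcal R_t(x)(\omega)}{t},D\right)=0.$$ -/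

import Mathlib

open MeasureTheory Filter Topology
open scoped Pointwise ENNReal

/-- `(τ k)` for `k : ℤ` is an ergodic group of measure preserving transformations of the
probability space `(Ω, P)`. -/
structure IsErgodicGroup {Ω : Type*} [MeasurableSpace Ω] (P : Measure Ω) (τ : ℤ → Ω → Ω) :
    Prop where
  zero : τ 0 = id
  add : ∀ k k' : ℤ, τ (k + k') = τ k ∘ τ k'
  measurePreserving : ∀ k : ℤ, MeasurePreserving (τ k) P P
  ergodic : ∀ U : Set Ω, MeasurableSet U → (∀ k : ℤ, τ k '' U = U) → P U = 1 ∨ P U = 0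

/-- Assumption (A) on the velocity `a = a(x, t, ω)`: joint measurability, `ℤⁿ`-periodicity in `x`
together with stationarity in `t`, Lipschitz continuity in `(x, t)` for each `ω` (with a constant
that may depend on `ω`), and uniform bounds from above and away from zero. -/
structure VelocityAssumption {n : ℕ} {Ω : Type*} [MeasurableSpace Ω] (τ : ℤ → Ω → Ω)
    (a : EuclideanSpace ℝ (Fin n) → ℝ → Ω → ℝ) : Prop where
  measurable : Measurable fun p : (EuclideanSpace ℝ (Fin n) × ℝ) × Ω => a p.1.1 p.1.2 p.2
  periodic_stationary : ∀ (x : EuclideanSpace ℝ (Fin n)) (l : Fin n → ℤ) (t : ℝ) (k : ℤ) (ω : Ω),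
    a (x + WithLp.toLp 2 fun i => (l i : ℝ)) t (τ k ω) = a x (t + k) ω
  lipschitz : ∀ ω : Ω, ∃ K : NNReal,
    LipschitzWith K fun p : EuclideanSpace ℝ (Fin n) × ℝ => a p.1 p.2 ω
  bounds : ∃ α β : ℝ, 0 < α ∧ 0 < β ∧
    ∀ (x : EuclideanSpace ℝ (Fin n)) (t : ℝ) (ω : Ω), α ≤ a x t ω ∧ a x t ω ≤ β

/-- `γ` is an admissible path on `[s, t]` for the velocity `a(·, ·, ω)`: it is absolutely
continuous on `[s, t]` and `|γ'(r)| ≤ a(γ(r), r, ω)` for almost every `r ∈ [s, t]`. Only the values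
of `γ` on `[s, t]` matter. -/
def IsAdmissiblePath {n : ℕ} {Ω : Type*} (a : EuclideanSpace ℝ (Fin n) → ℝ → Ω → ℝ) (ω : Ω)
    (s t : ℝ) (γ : ℝ → EuclideanSpace ℝ (Fin n)) : Prop :=
  AbsolutelyContinuousOnInterval γ s t ∧
    ∀ᵐ r ∂(volume.restrict (Set.Icc s t)),
      DifferentiableAt ℝ γ r ∧ ‖deriv γ r‖ ≤ a (γ r) r ω

/-- The set of points reachable at time `t` by admissible paths that start from `x` at time `s`. -/
def reachableSetFrom {n : ℕ} {Ω : Type*} (a : EuclideanSpace ℝ (Fin n) → ℝ → Ω → ℝ) (ω : Ω)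
    (s t : ℝ) (x : EuclideanSpace ℝ (Fin n)) : Set (EuclideanSpace ℝ (Fin n)) :=
  {y | ∃ γ : ℝ → EuclideanSpace ℝ (Fin n), IsAdmissiblePath a ω s t γ ∧ γ s = x ∧ γ t = y}

/-- The reachable set `R_t(x)(ω)`, with initial time `0`. -/
def reachableSet {n : ℕ} {Ω : Type*} (a : EuclideanSpace ℝ (Fin n) → ℝ → Ω → ℝ) (ω : Ω)
    (t : ℝ) (x : EuclideanSpace ℝ (Fin n)) : Set (EuclideanSpace ℝ (Fin n)) :=
  reachableSetFrom a ω 0 t x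

/-- The closed unit cell `Y = [0,1]ⁿ`. -/
def unitCell (n : ℕ) : Set (EuclideanSpace ℝ (Fin n)) :=
  {x | ∀ i, x i ∈ Set.Icc (0 : ℝ) 1}

/-! For a direction `p`, let `H(s,t)` be the supremum of `⟪p, v⟫` over all displacements `v` of
admissible paths on `[s,t]`, with any starting point. Cutting paths makes `H` subadditive over
adjacent intervals. Conversely, since `a ≥ α > 0` and `a` is periodic in space, a path can reach an
integer translate of any given point within time `√n / α` and then copy any other path
(`hasMemoryBound_of_periodic`). Hence `H` is additive up to a constant depending on neither the
interval nor `ω`.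

By stationarity, `H(j, j+N)` is `H(0,N)` evaluated at `τ j ω`. Because of the almost additivity,
Birkhoff's theorem for each bounded observable `H(0,N)` already gives an almost sure deterministic
limit `h p` of `H(0,M)/M` (`exists_tendsto_div_of_almost_additive`); no subadditive ergodic theorem
is needed. Lipschitz continuity in `p` makes the convergence uniform over directions, on one event
of full measure.

The set `D` is `wulffShape h`, the convex set with support function `h`. Rescaled displacements lie
near `D` because their support functions do. Support functions only see convex hulls, so the other
inclusion needs an argument (`exists_mem_reach_norm_sub_sq_le`): to follow `T • d`, split `[0,T]`
into `m` pieces and on each one choose a displacement that nearly maximizes the inner product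
against the current error. Apart from lower order terms, squared errors then add, giving an error of
order `T/√m`. Nothing depends on the starting point beyond the memory bound, hence the uniformity
over the cell. -/

open scoped BoundedContinuousFunction

/-! ### Birkhoff's pointwise ergodic theorem for bounded observables -/

/-- The running maximum of the Birkhoff sums `0, f, f + f ∘ T, …` of order at most `n`. -/
def maxBirkhoffSum {Ω : Type*} (T : Ω → Ω) (f : Ω → ℝ) : ℕ → Ω → ℝ
  | 0 => fun _ => 0
  | n + 1 => fun x => max 0 (f x + maxBirkhoffSum T f n (T x))

section Birkhoff

variable {Ω : Type*} {T : Ω → Ω} {f : Ω → ℝ}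

theorem maxBirkhoffSum_nonneg (n : ℕ) (x : Ω) : 0 ≤ maxBirkhoffSum T f n x := by
  cases n <;> simp [maxBirkhoffSum]

theorem maxBirkhoffSum_le_succ (n : ℕ) (x : Ω) :
    maxBirkhoffSum T f n x ≤ maxBirkhoffSum T f (n + 1) x := by
  induction n generalizing x with
  | zero => exact maxBirkhoffSum_nonneg _ _
  | succ n ih =>
    simp only [maxBirkhoffSum] at ih ⊢
    gcongr
    exact ih (T x)

theorem monotone_maxBirkhoffSum (x : Ω) : Monotone fun n => maxBirkhoffSum T f n x :=
  monotone_nat_of_le_succ fun n => maxBirkhoffSum_le_succ n x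

theorem birkhoffSum_le_maxBirkhoffSum (n : ℕ) (x : Ω) :
    birkhoffSum T f n x ≤ maxBirkhoffSum T f n x := by
  induction n generalizing x with
  | zero => simp [maxBirkhoffSum]
  | succ n ih =>
    rw [birkhoffSum_succ']
    simp only [maxBirkhoffSum]
    exact le_max_of_le_right (by gcongr; exact ih (T x))

/-- The increment used in the maximal argument: the right side equals `f x` as soon as the maximum
at `T x` is at least `-f x`. -/
theorem maxBirkhoffSum_succ_sub (n : ℕ) (x : Ω) :
    maxBirkhoffSum T f (n + 1) x - maxBirkhoffSum T f n (T x) =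
      max (-maxBirkhoffSum T f n (T x)) (f x) := by
  simp only [maxBirkhoffSum]
  rw [← max_sub_sub_right]
  simp

theorem abs_maxBirkhoffSum_le {B : ℝ} (hB : ∀ x, |f x| ≤ B) (n : ℕ) (x : Ω) :
    |maxBirkhoffSum T f n x| ≤ n * B := by
  rw [abs_of_nonneg (maxBirkhoffSum_nonneg _ _)]
  induction n generalizing x with
  | zero => simp [maxBirkhoffSum]
  | succ n ih =>
    have h0 : 0 ≤ B := (abs_nonneg _).trans (hB x)
    simp only [maxBirkhoffSum]
    push_cast
    refine max_le (by positivity) ?_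
    linarith [ih (T x), (abs_le.1 (hB x)).2]

variable [MeasurableSpace Ω]

theorem measurable_maxBirkhoffSum (hT : Measurable T) (hf : Measurable f) (n : ℕ) :
    Measurable (maxBirkhoffSum T f n) := by
  induction n with
  | zero => exact measurable_const
  | succ n ih => exact measurable_const.max (hf.add (ih.comp hT))

/-- If `∫ f < 0` then the Birkhoff sums of `f` are almost everywhere bounded from above. -/
theorem Ergodic.ae_bddAbove_birkhoffSum {P : Measure Ω} [IsProbabilityMeasure P]
    (hT : Ergodic T P) (hf : Measurable f) {B : ℝ} (hB : ∀ x, |f x| ≤ B)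
    (hneg : ∫ x, f x ∂P < 0) :
    ∀ᵐ x ∂P, ∃ b : ℝ, ∀ n, birkhoffSum T f n x ≤ b := by
  have hTm := hT.toMeasurePreserving.measurable
  set M := maxBirkhoffSum T f with hM
  -- The set of unbounded maxima is invariant, so it has measure 0 or 1. Measure 1 is excluded by
  -- showing `0 ≤ ∫ x in A, f x`.
  let A : Set Ω := {x | ∀ k : ℕ, ∃ n, (k : ℝ) < M n x}
  have hMm : ∀ n, Measurable (M n) := measurable_maxBirkhoffSum hTm hf
  have hA : MeasurableSet A := by
    have : A = ⋂ k : ℕ, ⋃ n, {x | (k : ℝ) < M n x} := by ext; simp [A]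
    rw [this]
    exact .iInter fun k => .iUnion fun n => measurableSet_lt measurable_const (hMm n)
  have hAinv : T ⁻¹' A = A := by
    ext x
    simp only [A, Set.mem_preimage, Set.mem_ofPred_eq]
    constructor
    · intro h k
      obtain ⟨j, hj⟩ := exists_nat_gt ((k : ℝ) - f x)
      obtain ⟨n, hn⟩ := h j
      exact ⟨n + 1, lt_max_of_lt_right (by change _ < f x + M n (T x); linarith)⟩
    · intro h k
      obtain ⟨j, hj⟩ := exists_nat_gt ((k : ℝ) + f x)
      obtain ⟨n, hn⟩ := h j
      cases n with
      | zero => exact absurd hn (not_lt.2 (Nat.cast_nonneg j))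
      | succ n =>
        refine ⟨n, ?_⟩
        rcases lt_max_iff.1 hn with h1 | h1
        · exact absurd h1 (not_lt.2 (Nat.cast_nonneg j))
        · change _ < f x + M n (T x) at h1
          linarith
  have hint : ∀ n, Integrable (M n) P := fun n =>
    Integrable.of_bound (hMm n).aestronglyMeasurable (n * B)
      (.of_forall fun x => abs_maxBirkhoffSum_le hB n x)
  have hintT : ∀ n, Integrable (fun x => M n (T x)) P := fun n =>
    hT.toMeasurePreserving.integrable_comp_of_integrable (hint n)
  have hshift : ∀ n, ∫ x in A, M n (T x) ∂P = ∫ x in A, M n x ∂P := by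
    intro n
    have h := (hT.toMeasurePreserving.restrict_preimage hA)
    rw [hAinv] at h
    calc ∫ x in A, M n (T x) ∂P = ∫ y, M n y ∂((P.restrict A).map T) :=
          (integral_map h.measurable.aemeasurable (hMm n).aestronglyMeasurable).symm
      _ = ∫ x in A, M n x ∂P := by rw [h.map_eq]
  have hlim : Tendsto (fun n => ∫ x in A, max (-M n (T x)) (f x) ∂P) atTop
      (𝓝 (∫ x in A, f x ∂P)) := by
    refine tendsto_integral_of_dominated_convergence (fun _ => B)
      (fun n => ((hMm n).comp hTm).neg.max hf |>.aestronglyMeasurable)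
      (integrable_const B) (fun n => .of_forall fun x => ?_) ?_
    · have h1 := maxBirkhoffSum_nonneg (T := T) (f := f) n (T x)
      have h2 := abs_le.1 (hB x)
      rw [Real.norm_eq_abs, abs_le]
      exact ⟨le_max_of_le_right h2.1, max_le (by change -M n (T x) ≤ B; linarith) h2.2⟩
    · filter_upwards [ae_restrict_mem hA] with x hx
      have hTx : T x ∈ A := by rw [← hAinv] at hx; exact hx
      obtain ⟨j, hj⟩ := exists_nat_gt (-f x)
      obtain ⟨n, hn⟩ := hTx j
      refine tendsto_const_nhds.congr' ?_
      filter_upwards [eventually_ge_atTop n] with m hm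
      have := monotone_maxBirkhoffSum (T := T) (f := f) (T x) hm
      rw [max_eq_right]
      change M n (T x) ≤ M m (T x) at this
      linarith
  have hpos : 0 ≤ ∫ x in A, f x ∂P := by
    refine ge_of_tendsto' hlim fun n => ?_
    have : ∫ x in A, max (-M n (T x)) (f x) ∂P = ∫ x in A, (M (n + 1) x - M n x) ∂P := by
      rw [integral_sub (hint _).integrableOn (hint _).integrableOn, ← hshift n,
        ← integral_sub (hint _).integrableOn (hintT _).integrableOn]
      exact integral_congr_ae (.of_forall fun x => (maxBirkhoffSum_succ_sub n x).symm)
    rw [this]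
    exact integral_nonneg fun x => sub_nonneg.2 (maxBirkhoffSum_le_succ n x)
  have hA0 : P A = 0 := by
    rcases hT.toPreErgodic.prob_eq_zero_or_one hA hAinv with h | h
    · exact h
    · have h1 : P.restrict A = P :=
        Measure.restrict_eq_self_of_ae_mem ((mem_ae_iff_prob_eq_one hA).2 h)
      rw [h1] at hpos
      linarith
  filter_upwards [measure_eq_zero_iff_ae_notMem.1 hA0] with x hx
  simp only [A, Set.mem_ofPred_eq, not_forall, not_exists, not_lt] at hx
  obtain ⟨k, hk⟩ := hx
  exact ⟨k, fun n => (birkhoffSum_le_maxBirkhoffSum n x).trans (hk n)⟩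

theorem Ergodic.ae_eventually_birkhoffAverage_lt {P : Measure Ω} [IsProbabilityMeasure P]
    (hT : Ergodic T P) (hf : Measurable f) {B : ℝ} (hB : ∀ x, |f x| ≤ B) {ε : ℝ} (hε : 0 < ε) :
    ∀ᵐ x ∂P, ∀ᶠ n : ℕ in atTop, (n : ℝ)⁻¹ * birkhoffSum T f n x < ∫ x, f x ∂P + ε := by
  set m := ∫ x, f x ∂P
  have hfi : Integrable f P := Integrable.of_bound hf.aestronglyMeasurable B (.of_forall hB)
  -- The shift makes the mean `-ε / 2`; a bound `b` on the shifted sums makes the averages at most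
  -- `m + ε / 2 + b / n`.
  have key := hT.ae_bddAbove_birkhoffSum (f := fun x => f x - (m + ε / 2))
    (hf.sub measurable_const) (B := B + |m + ε / 2|)
    (fun x => (abs_sub _ _).trans (by gcongr; exact hB x))
    (by rw [integral_sub hfi (integrable_const _)]; simp; linarith)
  filter_upwards [key] with x ⟨b, hb⟩
  have hsum : ∀ n, birkhoffSum T (fun x => f x - (m + ε / 2)) n x =
      birkhoffSum T f n x - n * (m + ε / 2) := by
    intro n
    simp [birkhoffSum, Finset.sum_sub_distrib, mul_add]
  obtain ⟨N, hN⟩ := exists_nat_gt (2 * b / ε)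
  filter_upwards [eventually_ge_atTop N, eventually_gt_atTop 0] with n hn hn0
  have h1 := hb n
  rw [hsum] at h1
  have hn' : (0 : ℝ) < n := by exact_mod_cast hn0
  have h2 : 2 * b / ε < n := hN.trans_le (by exact_mod_cast hn)
  rw [div_lt_iff₀ hε] at h2
  rw [inv_mul_lt_iff₀ hn']
  nlinarith

/-- **Birkhoff's ergodic theorem** for bounded measurable functions and ergodic maps. -/
theorem Ergodic.ae_tendsto_birkhoffSum {P : Measure Ω} [IsProbabilityMeasure P]
    (hT : Ergodic T P) (hf : Measurable f) {B : ℝ} (hB : ∀ x, |f x| ≤ B) :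
    ∀ᵐ x ∂P, Tendsto (fun n : ℕ => (n : ℝ)⁻¹ * birkhoffSum T f n x) atTop
      (𝓝 (∫ x, f x ∂P)) := by
  have h1 : ∀ᵐ x ∂P, ∀ k : ℕ, ∀ᶠ n : ℕ in atTop,
      (n : ℝ)⁻¹ * birkhoffSum T f n x < ∫ x, f x ∂P + 1 / ((k : ℝ) + 1) :=
    ae_all_iff.2 fun k => hT.ae_eventually_birkhoffAverage_lt hf hB Nat.one_div_pos_of_nat
  have h2 : ∀ᵐ x ∂P, ∀ k : ℕ, ∀ᶠ n : ℕ in atTop,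
      (n : ℝ)⁻¹ * birkhoffSum T (-f) n x < ∫ x, (-f) x ∂P + 1 / ((k : ℝ) + 1) :=
    ae_all_iff.2 fun k => hT.ae_eventually_birkhoffAverage_lt hf.neg
      (B := B) (fun x => by simpa using hB x) Nat.one_div_pos_of_nat
  filter_upwards [h1, h2] with x hx1 hx2
  rw [Metric.tendsto_nhds]
  intro ε hε
  obtain ⟨k, hk⟩ := exists_nat_one_div_lt hε
  filter_upwards [hx1 k, hx2 k] with n a1 a2
  rw [birkhoffSum_neg] at a2
  simp only [Pi.neg_apply, integral_neg, mul_neg] at a2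
  rw [Real.dist_eq, abs_lt]
  constructor <;> linarith

end Birkhoff

/-! ### Integral characterization of admissible paths -/

/-- `γ` is continuous on `[s, t]` and its increments are bounded by the integral of the speed `b`
along `γ`. -/
structure IsSpeedPath {E : Type*} [NormedAddCommGroup E] (b : E → ℝ → ℝ) (s t : ℝ) (γ : ℝ → E) :
    Prop where
  continuousOn : ContinuousOn γ (Set.Icc s t)
  norm_sub_le : ∀ r r', s ≤ r → r ≤ r' → r' ≤ t → ‖γ r' - γ r‖ ≤ ∫ u in r..r', b (γ u) u

/-- The points reached at time `t` by speed paths that start from `x` at time `s`. -/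
def reach {E : Type*} [NormedAddCommGroup E] (b : E → ℝ → ℝ) (s t : ℝ) (x : E) : Set E :=
  {y | ∃ γ : ℝ → E, IsSpeedPath b s t γ ∧ γ s = x ∧ γ t = y}

/-- A continuous speed with values in `[α, β]`, where `α > 0`. -/
structure IsSpeed {E : Type*} [NormedAddCommGroup E] (b : E → ℝ → ℝ) (α β : ℝ) : Prop where
  continuous : Continuous fun p : E × ℝ => b p.1 p.2
  pos : 0 < α
  lower : ∀ x t, α ≤ b x t
  upper : ∀ x t, b x t ≤ β

section SpeedPath

variable {E : Type*} [NormedAddCommGroup E] {b : E → ℝ → ℝ} {α β : ℝ} {s t u : ℝ} {x y z : E}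
  {γ : ℝ → E}

theorem IsSpeed.pos_upper (hb : IsSpeed b α β) : 0 < β :=
  hb.pos.trans_le ((hb.lower 0 0).trans (hb.upper 0 0))

theorem IsSpeed.intervalIntegrable (hb : IsSpeed b α β) (hγ : ContinuousOn γ (Set.Icc s t))
    {r r' : ℝ} (hr : s ≤ r) (hrr : r ≤ r') (hr' : r' ≤ t) :
    IntervalIntegrable (fun u => b (γ u) u) volume r r' := by
  refine ContinuousOn.intervalIntegrable ?_
  rw [Set.uIcc_of_le hrr]
  have h : ContinuousOn (fun u => (γ u, u)) (Set.Icc r r') :=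
    (hγ.mono (Set.Icc_subset_Icc hr hr')).prodMk continuousOn_id
  exact hb.continuous.comp_continuousOn h

theorem IsSpeed.integral_le (hb : IsSpeed b α β) (hγ : ContinuousOn γ (Set.Icc s t))
    {r r' : ℝ} (hr : s ≤ r) (hrr : r ≤ r') (hr' : r' ≤ t) :
    ∫ u in r..r', b (γ u) u ≤ β * (r' - r) := by
  calc _ ≤ ∫ u in r..r', β := intervalIntegral.integral_mono_on hrr
        (hb.intervalIntegrable hγ hr hrr hr') (by simp) fun _ _ => hb.upper _ _
    _ = _ := by simp [mul_comm]

theorem IsSpeed.le_integral (hb : IsSpeed b α β) (hγ : ContinuousOn γ (Set.Icc s t))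
    {r r' : ℝ} (hr : s ≤ r) (hrr : r ≤ r') (hr' : r' ≤ t) :
    α * (r' - r) ≤ ∫ u in r..r', b (γ u) u := by
  calc _ = ∫ u in r..r', α := by simp [mul_comm]
    _ ≤ _ := intervalIntegral.integral_mono_on hrr (by simp)
        (hb.intervalIntegrable hγ hr hrr hr') fun _ _ => hb.lower _ _

theorem IsSpeedPath.norm_sub_le_mul (h : IsSpeedPath b s t γ) (hb : IsSpeed b α β)
    {r r' : ℝ} (hr : s ≤ r) (hrr : r ≤ r') (hr' : r' ≤ t) : ‖γ r' - γ r‖ ≤ β * (r' - r) :=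
  (h.norm_sub_le r r' hr hrr hr').trans (hb.integral_le h.continuousOn hr hrr hr')

theorem IsSpeedPath.lipschitzOnWith (h : IsSpeedPath b s t γ) (hb : IsSpeed b α β) :
    LipschitzOnWith β.toNNReal γ (Set.Icc s t) := by
  refine LipschitzOnWith.of_dist_le_mul fun r hr r' hr' => ?_
  rw [Real.coe_toNNReal _ hb.pos_upper.le]
  rcases le_total r r' with hrr | hrr
  · rw [dist_comm, dist_eq_norm, dist_comm, Real.dist_eq, abs_of_nonneg (sub_nonneg.2 hrr)]
    exact h.norm_sub_le_mul hb hr.1 hrr hr'.2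
  · rw [dist_eq_norm, Real.dist_eq, abs_of_nonneg (sub_nonneg.2 hrr)]
    exact h.norm_sub_le_mul hb hr'.1 hrr hr.2

theorem norm_sub_le_of_mem_reach (hb : IsSpeed b α β) (hst : s ≤ t) (hy : y ∈ reach b s t x) :
    ‖y - x‖ ≤ β * (t - s) := by
  obtain ⟨γ, h, rfl, rfl⟩ := hy
  exact h.norm_sub_le_mul hb le_rfl hst le_rfl

theorem mem_reach_of_norm_sub_le [NormedSpace ℝ E] (hb : IsSpeed b α β)
    (hyx : ‖y - x‖ ≤ α * (t - s)) : y ∈ reach b s t x := by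
  rcases eq_or_ne s t with rfl | hne
  · have : y = x := by simpa [sub_eq_zero] using hyx
    subst this
    refine ⟨fun _ => y, ⟨continuousOn_const, fun r r' h1 h2 h3 => ?_⟩, rfl, rfl⟩
    have : r = r' := by linarith
    simp [this]
  have hst : s < t := lt_of_le_of_ne (by nlinarith [norm_nonneg (y - x), hb.pos]) hne
  have hst' : 0 < t - s := sub_pos.2 hst
  let γ : ℝ → E := fun r => x + ((r - s) / (t - s)) • (y - x)
  have hγ : Continuous γ := by fun_prop
  refine ⟨γ, ⟨hγ.continuousOn, fun r r' h1 h2 h3 => ?_⟩, by simp [γ],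
    by simp [γ, div_self hst'.ne']⟩
  refine le_trans ?_ (hb.le_integral hγ.continuousOn h1 h2 h3)
  have : γ r' - γ r = ((r' - r) / (t - s)) • (y - x) := by
    simp only [γ, add_sub_add_left_eq_sub, ← sub_smul]
    congr 1
    ring
  rw [this, norm_smul, Real.norm_eq_abs,
    abs_of_nonneg (div_nonneg (sub_nonneg.2 h2) hst'.le), div_mul_eq_mul_div, div_le_iff₀ hst']
  nlinarith [mul_le_mul_of_nonneg_left hyx (sub_nonneg.2 h2)]

theorem self_mem_reach [NormedSpace ℝ E] (hb : IsSpeed b α β) (hst : s ≤ t) :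
    x ∈ reach b s t x :=
  mem_reach_of_norm_sub_le hb (by simpa using mul_nonneg hb.pos.le (sub_nonneg.2 hst))

theorem IsSpeedPath.mono (h : IsSpeedPath b s t γ) {s' t' : ℝ} (hs : s ≤ s') (ht : t' ≤ t) :
    IsSpeedPath b s' t' γ :=
  ⟨h.continuousOn.mono (Set.Icc_subset_Icc hs ht),
    fun r r' h1 h2 h3 => h.norm_sub_le r r' (hs.trans h1) h2 (h3.trans ht)⟩

theorem exists_mem_reach_of_mem_reach (hy : y ∈ reach b s u x) (hst : s ≤ t) (htu : t ≤ u) :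
    ∃ z ∈ reach b s t x, y ∈ reach b t u z := by
  obtain ⟨γ, h, h1, h2⟩ := hy
  exact ⟨γ t, ⟨γ, h.mono le_rfl htu, h1, rfl⟩, γ, h.mono hst le_rfl, rfl, h2⟩

theorem IsSpeedPath.congr {γ' : ℝ → E} (h : IsSpeedPath b s t γ)
    (heq : Set.EqOn γ' γ (Set.Icc s t)) : IsSpeedPath b s t γ' := by
  refine ⟨h.continuousOn.congr heq, fun r r' h1 h2 h3 => ?_⟩
  rw [heq ⟨h1, h2.trans h3⟩, heq ⟨h1.trans h2, h3⟩]
  refine (h.norm_sub_le r r' h1 h2 h3).trans_eq (intervalIntegral.integral_congr fun v hv => ?_)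
  rw [Set.uIcc_of_le h2] at hv
  simp only [heq ⟨h1.trans hv.1, hv.2.trans h3⟩]

theorem IsSpeedPath.append (hb : IsSpeed b α β) (hst : s ≤ t) (htu : t ≤ u)
    (h1 : IsSpeedPath b s t γ) (h2 : IsSpeedPath b t u γ) : IsSpeedPath b s u γ := by
  have hc : ContinuousOn γ (Set.Icc s u) := by
    rw [← Set.Icc_union_Icc_eq_Icc hst htu]
    exact h1.continuousOn.union_of_isClosed h2.continuousOn isClosed_Icc isClosed_Icc
  refine ⟨hc, fun r r' hr hrr hr' => ?_⟩
  rcases le_total r' t with h | h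
  · exact h1.norm_sub_le r r' hr hrr h
  rcases le_total t r with h' | h'
  · exact h2.norm_sub_le r r' h' hrr hr'
  rw [← intervalIntegral.integral_add_adjacent_intervals
    (hb.intervalIntegrable hc hr h' htu) (hb.intervalIntegrable hc hst h hr')]
  calc ‖γ r' - γ r‖ ≤ ‖γ t - γ r‖ + ‖γ r' - γ t‖ := by
        rw [add_comm]; exact norm_sub_le_norm_sub_add_norm_sub _ _ _
    _ ≤ _ := add_le_add (h1.norm_sub_le r t hr h' le_rfl) (h2.norm_sub_le t r' le_rfl h hr')

theorem reach_trans (hb : IsSpeed b α β) (hst : s ≤ t) (htu : t ≤ u) (hy : y ∈ reach b s t x)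
    (hz : z ∈ reach b t u y) : z ∈ reach b s u x := by
  obtain ⟨γ₁, h1, rfl, rfl⟩ := hy
  obtain ⟨γ₂, h2, h3, rfl⟩ := hz
  let γ : ℝ → E := fun r => if r ≤ t then γ₁ r else γ₂ r
  have e1 : Set.EqOn γ γ₁ (Set.Icc s t) := fun r hr => if_pos hr.2
  have e2 : Set.EqOn γ γ₂ (Set.Icc t u) := fun r hr => by
    rcases hr.1.eq_or_lt with rfl | h
    · simp [γ, h3]
    · simp [γ, not_le.2 h]
  exact ⟨γ, (h1.congr e1).append hb hst htu (h2.congr e2), e1 ⟨le_rfl, hst⟩, e2 ⟨htu, le_rfl⟩⟩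

theorem add_mem_reach_add {l : E} (hl : ∀ x t, b (x + l) t = b x t) (hy : y ∈ reach b s t x) :
    y + l ∈ reach b s t (x + l) := by
  obtain ⟨γ, h, rfl, rfl⟩ := hy
  refine ⟨fun r => γ r + l, ⟨h.continuousOn.add continuousOn_const, fun r r' h1 h2 h3 => ?_⟩,
    rfl, rfl⟩
  simpa [hl] using h.norm_sub_le r r' h1 h2 h3

theorem reach_comp_add_subset (k : ℝ) :
    reach (fun x r => b x (r + k)) s t x ⊆ reach b (s + k) (t + k) x := by
  rintro y ⟨γ, h, rfl, rfl⟩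
  refine ⟨fun r => γ (r - k), ⟨h.continuousOn.comp (by fun_prop) fun r hr => ?_,
    fun r r' h1 h2 h3 => ?_⟩, by simp, by simp⟩
  · exact ⟨by linarith [hr.1], by linarith [hr.2]⟩
  · have := h.norm_sub_le (r - k) (r' - k) (by linarith) (by linarith) (by linarith)
    rw [← intervalIntegral.integral_comp_sub_right (fun v => b (γ v) (v + k))] at this
    simpa using this

theorem reach_comp_add (k : ℝ) :
    reach (fun x r => b x (r + k)) s t x = reach b (s + k) (t + k) x := by
  refine (reach_comp_add_subset k).antisymm ?_
  have := reach_comp_add_subset (b := fun x r => b x (r + k)) (s := s + k) (t := t + k) (x := x)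
    (-k)
  simpa using this

end SpeedPath

/-! ### Equivalence of the differential and integral speed constraints. -/

section Characterization

variable {E : Type*} [NormedAddCommGroup E] [InnerProductSpace ℝ E]

theorem AbsolutelyContinuousOnInterval.inner_left {γ : ℝ → E} {s t : ℝ}
    (h : AbsolutelyContinuousOnInterval γ s t) (v : E) :
    AbsolutelyContinuousOnInterval (fun r => inner ℝ v (γ r)) s t := by
  have h' := Tendsto.const_mul ‖v‖ h
  rw [mul_zero] at h'
  refine squeeze_zero (fun _ => Finset.sum_nonneg fun _ _ => dist_nonneg) (fun I => ?_) h'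
  rw [Finset.mul_sum]
  refine Finset.sum_le_sum fun i _ => ?_
  rw [Real.dist_eq, ← inner_sub_right, dist_eq_norm]
  exact abs_real_inner_le_norm _ _

/-- The scalar fundamental theorem of calculus suffices: apply it to `⟪v, γ ·⟫` with `v` the
increment itself, then divide by `‖v‖`. -/
theorem IsSpeedPath.of_absolutelyContinuous {b : E → ℝ → ℝ} {α β s t : ℝ} {γ : ℝ → E}
    (hb : IsSpeed b α β) (hst : s ≤ t) (h : AbsolutelyContinuousOnInterval γ s t)
    (hd : ∀ᵐ r ∂(volume.restrict (Set.Icc s t)), DifferentiableAt ℝ γ r ∧ ‖deriv γ r‖ ≤ b (γ r) r) :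
    IsSpeedPath b s t γ := by
  have hc : ContinuousOn γ (Set.Icc s t) := by
    have := h.continuousOn
    rwa [Set.uIcc_of_le hst] at this
  refine ⟨hc, fun r r' h1 h2 h3 => ?_⟩
  set v := γ r' - γ r
  have hac := (h.inner_left v).mono (c := r) (d := r') (by
    rw [Set.uIcc_of_le hst, Set.uIcc_of_le h2]; exact Set.Icc_subset_Icc h1 h3)
  have hint := hb.intervalIntegrable hc h1 h2 h3
  have key : ‖v‖ * ‖v‖ ≤ ‖v‖ * ∫ u in r..r', b (γ u) u := by
    calc ‖v‖ * ‖v‖ = inner ℝ v (γ r') - inner ℝ v (γ r) := by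
          rw [← inner_sub_right, real_inner_self_eq_norm_mul_norm]
      _ = ∫ u in r..r', deriv (fun r => inner ℝ v (γ r)) u := hac.integral_deriv_eq_sub.symm
      _ ≤ ∫ u in r..r', ‖v‖ * b (γ u) u := by
          refine intervalIntegral.integral_mono_ae_restrict h2 hac.intervalIntegrable_deriv
            (hint.const_mul _) ?_
          filter_upwards [ae_restrict_of_ae_restrict_of_subset (Set.Icc_subset_Icc h1 h3) hd]
            with u hu
          have : HasDerivAt (fun r => inner ℝ v (γ r)) (inner ℝ v (deriv γ u)) u := by
            simpa using (hasDerivAt_const u v).inner ℝ hu.1.hasDerivAt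
          rw [this.deriv]
          exact (real_inner_le_norm _ _).trans (by gcongr; exact hu.2)
      _ = _ := by rw [intervalIntegral.integral_const_mul]
  rcases (norm_nonneg v).eq_or_lt with h0 | h0
  · rw [← h0]
    exact (mul_nonneg hb.pos.le (sub_nonneg.2 h2)).trans (hb.le_integral hc h1 h2 h3)
  · exact le_of_mul_le_mul_left key h0

/-- By continuity, the speed along `γ` stays below `b (γ r) r + ε` near `r`, which is then a local
Lipschitz constant for `γ`. -/
theorem IsSpeedPath.norm_deriv_le {b : E → ℝ → ℝ} {α β s t : ℝ} {γ : ℝ → E}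
    (hb : IsSpeed b α β) (h : IsSpeedPath b s t γ) {r : ℝ} (hr : r ∈ Set.Ioo s t)
    (hd : DifferentiableAt ℝ γ r) : ‖deriv γ r‖ ≤ b (γ r) r := by
  refine le_of_forall_pos_le_add fun ε hε => ?_
  have hcont : ContinuousAt (fun u => b (γ u) u) r :=
    hb.continuous.continuousAt.comp (f := fun u => (γ u, u)) (hd.continuousAt.prodMk continuousAt_id)
  have h1 : ∀ᶠ u in 𝓝 r, b (γ u) u < b (γ r) r + ε := hcont.eventually_lt_const (by linarith)
  obtain ⟨δ, hδ, hball⟩ := Metric.eventually_nhds_iff.1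
    (h1.and (Ioo_mem_nhds hr.1 hr.2))
  have hC : 0 ≤ b (γ r) r + ε := by linarith [hb.pos, hb.lower (γ r) r]
  have bound : ∀ p q, p ≤ q → dist p r < δ → dist q r < δ →
      ‖γ q - γ p‖ ≤ (b (γ r) r + ε) * (q - p) := by
    intro p q hpq hp hq
    have hp' := (hball hp).2
    have hq' := (hball hq).2
    refine (h.norm_sub_le p q hp'.1.le hpq hq'.2.le).trans ?_
    calc _ ≤ ∫ u in p..q, (b (γ r) r + ε) := by
          refine intervalIntegral.integral_mono_on hpq
            (hb.intervalIntegrable h.continuousOn hp'.1.le hpq hq'.2.le) (by simp) fun u hu => ?_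
          refine (hball ?_).1.le
          rw [Real.dist_eq, abs_lt] at hp hq ⊢
          constructor <;> linarith [hu.1, hu.2]
      _ = _ := by rw [intervalIntegral.integral_const, smul_eq_mul, mul_comm]
  refine hd.hasDerivAt.le_of_lip' hC ?_
  rw [Metric.eventually_nhds_iff]
  refine ⟨δ, hδ, fun {p} hp => ?_⟩
  have h0 : dist r r < δ := by simpa using hδ
  rcases le_total p r with hpr | hpr
  · rw [norm_sub_rev, norm_sub_rev p r, Real.norm_eq_abs, abs_of_nonneg (sub_nonneg.2 hpr)]
    exact bound p r hpr hp h0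
  · rw [Real.norm_eq_abs, abs_of_nonneg (sub_nonneg.2 hpr)]
    exact bound r p hpr h0 hp

/-- Passes to the integral form, which is stable under gluing and uniform limits. Conversely, speed
paths are Lipschitz, hence differentiable almost everywhere. -/
theorem reachableSetFrom_eq_reach {n : ℕ} {Ω : Type*} {a : EuclideanSpace ℝ (Fin n) → ℝ → Ω → ℝ}
    {ω : Ω} {α β s t : ℝ} (hb : IsSpeed (fun x r => a x r ω) α β) (hst : s ≤ t)
    (x : EuclideanSpace ℝ (Fin n)) :
    reachableSetFrom a ω s t x = reach (fun x r => a x r ω) s t x := by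
  ext y
  constructor
  · rintro ⟨γ, hγ, h1, h2⟩
    exact ⟨γ, .of_absolutelyContinuous hb hst hγ.1 hγ.2, h1, h2⟩
  · rintro ⟨γ, hγ, h1, h2⟩
    have hL := hγ.lipschitzOnWith hb
    refine ⟨γ, ⟨LipschitzOnWith.absolutelyContinuousOnInterval
      (by rw [Set.uIcc_of_le hst]; exact hL), ?_⟩, h1, h2⟩
    rw [← Measure.restrict_congr_set Ioo_ae_eq_Icc]
    filter_upwards [ae_restrict_mem measurableSet_Ioo,
      (hL.mono Set.Ioo_subset_Icc_self).ae_differentiableWithinAt_real measurableSet_Ioo]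
      with r hr hd
    have hd' := hd.differentiableAt (Ioo_mem_nhds hr.1 hr.2)
    exact ⟨hd', hγ.norm_deriv_le hb hr hd'⟩

end Characterization

/-! ### Loss of memory and almost additivity of the support functions -/

/-- The displacements of speed paths on `[s, t]`, from arbitrary starting points. -/
def displacements {E : Type*} [NormedAddCommGroup E] (b : E → ℝ → ℝ) (s t : ℝ) : Set E :=
  {v | ∃ x, x + v ∈ reach b s t x}

/-- The support function of the set of displacements on `[s, t]`. -/
noncomputable def displacementSupport {E : Type*} [NormedAddCommGroup E] [InnerProductSpace ℝ E]
    (b : E → ℝ → ℝ) (s t : ℝ) (p : E) : ℝ :=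
  sSup ((fun v => inner ℝ p v) '' displacements b s t)

/-- Any displacement can be realized from any starting point, up to an error of norm `C` which does
not depend on the time interval. -/
def HasMemoryBound {E : Type*} [NormedAddCommGroup E] (b : E → ℝ → ℝ) (C : ℝ) : Prop :=
  ∀ s t, s ≤ t → ∀ v ∈ displacements b s t, ∀ x, ∃ v', x + v' ∈ reach b s t x ∧ ‖v' - v‖ ≤ C

/-- The integer vector `l`, as a point of the Euclidean space. -/
noncomputable def intVec {n : ℕ} (l : Fin n → ℤ) : EuclideanSpace ℝ (Fin n) :=
  WithLp.toLp 2 fun i => (l i : ℝ)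

theorem norm_le_sqrt_of_mem_unitCell {n : ℕ} {z : EuclideanSpace ℝ (Fin n)}
    (hz : z ∈ unitCell n) : ‖z‖ ≤ √n := by
  rw [EuclideanSpace.norm_eq]
  refine Real.sqrt_le_sqrt ?_
  calc ∑ i, ‖z i‖ ^ 2 ≤ ∑ _i : Fin n, (1 : ℝ) := by
        refine Finset.sum_le_sum fun i _ => ?_
        rw [Real.norm_eq_abs, abs_of_nonneg (hz i).1]
        exact pow_le_one₀ (hz i).1 (hz i).2
    _ = n := by simp

theorem exists_intVec_sub_mem_unitCell {n : ℕ} (z : EuclideanSpace ℝ (Fin n)) :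
    ∃ l : Fin n → ℤ, z - intVec l ∈ unitCell n := by
  refine ⟨fun i => ⌊z i⌋, fun i => ?_⟩
  have : (z - intVec fun i => ⌊z i⌋) i = Int.fract (z i) := by simp [intVec]
  rw [this]
  exact ⟨Int.fract_nonneg _, (Int.fract_lt_one _).le⟩

theorem isCompact_unitCell (n : ℕ) : IsCompact (unitCell n) := by
  refine Metric.isCompact_of_isClosed_isBounded ?_ ?_
  · have : unitCell n = ⋂ i, (fun x : EuclideanSpace ℝ (Fin n) => x i) ⁻¹' Set.Icc (0 : ℝ) 1 := by
      ext x
      simp [unitCell]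
    rw [this]
    exact isClosed_iInter fun i => isClosed_Icc.preimage (by fun_prop)
  · exact isBounded_iff_forall_norm_le.2 ⟨_, fun x hx => norm_le_sqrt_of_mem_unitCell hx⟩

/-- Let the given path be at `z` at time `s + √n / α`. Some integer translate of `z` lies within
`√n` of `x`, so it is reached by that time; afterwards the translated path is followed. The
translation mismatch costs `√n`, and dropping the initial piece costs `β * (√n / α)`. -/
theorem hasMemoryBound_of_periodic {n : ℕ} {b : EuclideanSpace ℝ (Fin n) → ℝ → ℝ} {α β : ℝ}
    (hb : IsSpeed b α β) (hper : ∀ x l t, b (x + intVec l) t = b x t) :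
    HasMemoryBound b (√n + β * (√n / α)) := by
  rintro s t hst v ⟨x₀, hv⟩ x
  have hβ := hb.pos_upper
  have hα := hb.pos
  set T := √n / α with hT
  have hT0 : 0 ≤ T := by positivity
  rcases le_total t (s + T) with h | h
  -- On a short interval it is enough to stay at `x`.
  · refine ⟨0, by simpa using self_mem_reach hb hst, ?_⟩
    have h1 := norm_sub_le_of_mem_reach hb hst hv
    simp only [add_sub_cancel_left] at h1
    have h2 : β * (t - s) ≤ β * T := by gcongr; linarith
    simp only [zero_sub, norm_neg]
    linarith [Real.sqrt_nonneg (n : ℝ)]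
  · obtain ⟨z, hz, hyz⟩ := exists_mem_reach_of_mem_reach hv (le_add_of_nonneg_right hT0) h
    obtain ⟨l, hl⟩ := exists_intVec_sub_mem_unitCell (x - z)
    have hl' := norm_le_sqrt_of_mem_unitCell hl
    have hz' := norm_sub_le_of_mem_reach hb (le_add_of_nonneg_right hT0) hz
    have e1 : z + intVec l - x = -(x - z - intVec l) := by abel
    have h1 : z + intVec l ∈ reach b s (s + T) x := by
      refine mem_reach_of_norm_sub_le hb ?_
      rw [e1, norm_neg, add_sub_cancel_left, hT, mul_div_cancel₀ _ hα.ne']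
      exact hl'
    have h2 := add_mem_reach_add (fun x t => hper x l t) hyz
    refine ⟨x₀ + v + intVec l - x, ?_, ?_⟩
    · rw [add_sub_cancel]
      exact reach_trans hb (le_add_of_nonneg_right hT0) h h1 h2
    · have e2 : x₀ + v + intVec l - x - v = -(x - z - intVec l) - (z - x₀) := by abel
      rw [e2]
      refine (norm_sub_le _ _).trans (add_le_add (by rwa [norm_neg]) ?_)
      simpa using hz'

theorem norm_le_of_mem_displacements {E : Type*} [NormedAddCommGroup E] {b : E → ℝ → ℝ}
    {α β s t : ℝ} {v : E} (hb : IsSpeed b α β) (hst : s ≤ t)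
    (hv : v ∈ displacements b s t) : ‖v‖ ≤ β * (t - s) := by
  obtain ⟨x, hx⟩ := hv
  simpa using norm_sub_le_of_mem_reach hb hst hx

/-! ### Support functions of displacements and their almost additivity. -/

section Support

variable {E : Type*} [NormedAddCommGroup E] [InnerProductSpace ℝ E] {b : E → ℝ → ℝ}
  {α β C : ℝ} {s t u : ℝ} {p q v : E}

theorem zero_mem_displacements (hb : IsSpeed b α β) (hst : s ≤ t) :
    (0 : E) ∈ displacements b s t :=
  ⟨0, by simpa using self_mem_reach hb hst⟩

theorem inner_le_of_mem_displacements (hb : IsSpeed b α β) (hst : s ≤ t) (p : E)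
    (hv : v ∈ displacements b s t) : inner ℝ p v ≤ β * (t - s) * ‖p‖ := by
  refine (real_inner_le_norm _ _).trans ?_
  rw [mul_comm]
  gcongr
  exact norm_le_of_mem_displacements hb hst hv

theorem inner_le_displacementSupport (hb : IsSpeed b α β) (hst : s ≤ t) (p : E)
    (hv : v ∈ displacements b s t) : inner ℝ p v ≤ displacementSupport b s t p := by
  refine le_csSup ⟨β * (t - s) * ‖p‖, ?_⟩ ⟨v, hv, rfl⟩
  rintro _ ⟨w, hw, rfl⟩
  exact inner_le_of_mem_displacements hb hst p hw

theorem displacementSupport_le (hb : IsSpeed b α β) (hst : s ≤ t) {c : ℝ}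
    (h : ∀ v ∈ displacements b s t, inner ℝ p v ≤ c) : displacementSupport b s t p ≤ c := by
  refine csSup_le ⟨_, 0, zero_mem_displacements hb hst, rfl⟩ ?_
  rintro _ ⟨w, hw, rfl⟩
  exact h w hw

theorem exists_lt_inner_of_lt_displacementSupport (hb : IsSpeed b α β) (hst : s ≤ t) {c : ℝ}
    (hc : c < displacementSupport b s t p) : ∃ v ∈ displacements b s t, c < inner ℝ p v := by
  by_contra! h
  exact absurd (displacementSupport_le hb hst h) (not_le.2 hc)

theorem displacementSupport_nonneg (hb : IsSpeed b α β) (hst : s ≤ t) :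
    0 ≤ displacementSupport b s t p := by
  simpa using inner_le_displacementSupport hb hst p (zero_mem_displacements hb hst)

theorem displacementSupport_le_mul_norm (hb : IsSpeed b α β) (hst : s ≤ t) :
    displacementSupport b s t p ≤ β * (t - s) * ‖p‖ :=
  displacementSupport_le hb hst fun _ hv => inner_le_of_mem_displacements hb hst p hv

theorem displacementSupport_add_le (hb : IsSpeed b α β) (hst : s ≤ t) :
    displacementSupport b s t (p + q) ≤
      displacementSupport b s t p + displacementSupport b s t q := by
  refine displacementSupport_le hb hst fun v hv => ?_
  rw [inner_add_left]
  exact add_le_add (inner_le_displacementSupport hb hst p hv)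
    (inner_le_displacementSupport hb hst q hv)

theorem displacementSupport_smul {c : ℝ} (hc : 0 ≤ c) :
    displacementSupport b s t (c • p) = c * displacementSupport b s t p := by
  unfold displacementSupport
  rw [← smul_eq_mul, ← Real.sSup_smul_of_nonneg hc, ← Set.image_smul, Set.image_image]
  simp only [inner_smul_left, smul_eq_mul]
  rfl

theorem displacementSupport_sub_le (hb : IsSpeed b α β) (hst : s ≤ t) :
    displacementSupport b s t p - displacementSupport b s t q ≤ β * (t - s) * ‖p - q‖ := by
  have h1 := displacementSupport_add_le (p := p - q) (q := q) hb hst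
  have h2 := displacementSupport_le_mul_norm (p := p - q) hb hst
  rw [sub_add_cancel] at h1
  linarith

theorem displacementSupport_le_add (hb : IsSpeed b α β) (hst : s ≤ t) (htu : t ≤ u) :
    displacementSupport b s u p ≤
      displacementSupport b s t p + displacementSupport b t u p := by
  refine displacementSupport_le hb (hst.trans htu) ?_
  rintro v ⟨x, hv⟩
  obtain ⟨z, hz, hvz⟩ := exists_mem_reach_of_mem_reach hv hst htu
  have h1 := inner_le_displacementSupport hb hst p (v := z - x) ⟨x, by simpa using hz⟩
  have h2 := inner_le_displacementSupport hb htu p (v := x + v - z) ⟨z, by simpa using hvz⟩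
  rw [inner_sub_right] at h1 h2
  rw [inner_add_right] at h2
  linarith

theorem HasMemoryBound.inner_le (h : HasMemoryBound b C) (hst : s ≤ t)
    (hv : v ∈ displacements b s t) (x p : E) :
    ∃ v', x + v' ∈ reach b s t x ∧ inner ℝ p v ≤ inner ℝ p v' + C * ‖p‖ := by
  obtain ⟨v', h1, h2⟩ := h s t hst v hv x
  refine ⟨v', h1, ?_⟩
  have h3 := real_inner_le_norm p (v - v')
  rw [norm_sub_rev, inner_sub_right] at h3
  nlinarith [norm_nonneg p]

/-- The second displacement may start elsewhere; the memory bound restarts it at the endpoint of the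
first, at cost `C * ‖p‖`. -/
theorem add_le_displacementSupport (hb : IsSpeed b α β) (hC : HasMemoryBound b C) (hst : s ≤ t)
    (htu : t ≤ u) :
    displacementSupport b s t p + displacementSupport b t u p ≤
      displacementSupport b s u p + C * ‖p‖ := by
  have h1 : ∀ v ∈ displacements b s t, ∀ w ∈ displacements b t u,
      inner ℝ p v + inner ℝ p w ≤ displacementSupport b s u p + C * ‖p‖ := by
    rintro v ⟨x, hx⟩ w hw
    obtain ⟨w', hw', h⟩ := hC.inner_le htu hw (x + v) p
    have := inner_le_displacementSupport hb (hst.trans htu) p (v := v + w')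
      ⟨x, by rw [← add_assoc]; exact reach_trans hb hst htu hx hw'⟩
    rw [inner_add_right] at this
    linarith
  have h2 : ∀ w ∈ displacements b t u, displacementSupport b s t p ≤
      displacementSupport b s u p + C * ‖p‖ - inner ℝ p w := fun w hw =>
    displacementSupport_le hb hst fun v hv => by linarith [h1 v hv w hw]
  have h3 := displacementSupport_le (p := p)
    (c := displacementSupport b s u p + C * ‖p‖ - displacementSupport b s t p) hb htu
    fun w hw => by linarith [h2 w hw]
  linarith

theorem displacementSupport_comp_add (k : ℝ) :
    displacementSupport (fun x r => b x (r + k)) s t p =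
      displacementSupport b (s + k) (t + k) p := by
  simp only [displacementSupport, displacements, reach_comp_add]

end Support

/-! ### Compactness of reachable sets and measurability of the support functions -/

/-- An existence statement over a compact set of points satisfying uncountably many closed
constraints that depend measurably on a parameter defines a measurable set of parameters. -/
theorem IsCompact.measurableSet_exists_forall_le_zero {Ω X J : Type*} [MeasurableSpace Ω]
    [PseudoMetricSpace X] [TopologicalSpace J] [TopologicalSpace.SeparableSpace J] {Γ : Set X}
    (hΓ : IsCompact Γ) {F : Ω → X → J → ℝ} (hm : ∀ x j, Measurable fun ω => F ω x j)
    (hL : ∀ ω, ∃ L : ℝ, ∀ x y j, F ω x j - F ω y j ≤ L * dist x y)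
    (hJ : ∀ ω x, Continuous (F ω x)) :
    MeasurableSet {ω | ∃ x ∈ Γ, ∀ j, F ω x j ≤ 0} := by
  obtain ⟨Q, hQΓ, hQc, hQ⟩ := hΓ.isSeparable.exists_countable_dense_subset
  obtain ⟨D, hDc, hD⟩ := TopologicalSpace.exists_countable_dense J
  -- Slack `1 / (m + 1)` allows `x` to range over a countable dense set; a subsequential limit in
  -- `Γ` recovers an exact solution.
  have key : {ω | ∃ x ∈ Γ, ∀ j, F ω x j ≤ 0} =
      ⋂ m : ℕ, ⋃ x ∈ Q, ⋂ j ∈ D, {ω | F ω x j ≤ 1 / ((m : ℝ) + 1)} := by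
    ext ω
    simp only [Set.mem_ofPred_eq, Set.mem_iInter, Set.mem_iUnion, exists_prop]
    obtain ⟨L, hL⟩ := hL ω
    constructor
    · rintro ⟨x, hx, hxF⟩ m
      have hpos : 0 < 1 / (((m : ℝ) + 1) * (|L| + 1)) := by positivity
      obtain ⟨y, hy, hxy⟩ := Metric.mem_closure_iff.1 (hQ hx) _ hpos
      refine ⟨y, hy, fun j _ => ?_⟩
      have h1 := hL y x j
      have h2 : L * dist y x ≤ (|L| + 1) * (1 / (((m : ℝ) + 1) * (|L| + 1))) := by
        rw [dist_comm]
        gcongr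
        linarith [le_abs_self L]
      have h3 : (|L| + 1) * (1 / (((m : ℝ) + 1) * (|L| + 1))) = 1 / ((m : ℝ) + 1) := by
        field_simp
      linarith [hxF j]
    · intro h
      choose y hyQ hyF using h
      obtain ⟨x, hx, φ, hφ, hlim⟩ := hΓ.tendsto_subseq fun m => hQΓ (hyQ m)
      refine ⟨x, hx, fun j => ?_⟩
      have hcl : IsClosed {j | F ω x j ≤ 0} := isClosed_le (hJ ω x) continuous_const
      have hsub : D ⊆ {j | F ω x j ≤ 0} := by
        intro j hj
        have h1 : ∀ m, F ω x j ≤ L * dist x (y (φ m)) + 1 / ((φ m : ℝ) + 1) := fun m => by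
          linarith [hL x (y (φ m)) j, hyF (φ m) j hj]
        have h2 : Tendsto (fun m => L * dist x (y (φ m)) + 1 / ((φ m : ℝ) + 1)) atTop
            (𝓝 (L * dist x x + 0)) :=
          ((tendsto_const_nhds.dist hlim).const_mul L).add
            (tendsto_one_div_add_atTop_nhds_zero_nat.comp hφ.tendsto_atTop)
        simpa using ge_of_tendsto' h2 h1
      exact hcl.closure_subset_iff.2 hsub (hD j)
  rw [key]
  exact .iInter fun m => .biUnion hQc fun x _ => .biInter hDc fun j _ =>
    measurableSet_le (hm x j) measurable_const

/-! ### Compactness in the space of Lipschitz paths. -/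

section PathSpace

variable {E : Type*} [NormedAddCommGroup E] {T : ℝ}

/-- The amount by which the increment of `γ` between `r.1` and `r.2` exceeds the bound for speed
paths. -/
noncomputable def speedExcess (b : E → ℝ → ℝ) (hT : 0 ≤ T) (γ : Set.Icc (0 : ℝ) T →ᵇ E)
    (r : Set.Icc (0 : ℝ) T × Set.Icc (0 : ℝ) T) : ℝ :=
  ‖γ r.2 - γ r.1‖ - |∫ u in (r.1 : ℝ)..r.2, b (Set.IccExtend hT γ u) u|

/-- The space of `β`-Lipschitz paths on `[0, T]` that start in `K`. -/
def lipschitzPaths (T β : ℝ) (hT : 0 ≤ T) (K : Set E) : Set (Set.Icc (0 : ℝ) T →ᵇ E) :=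
  {γ | (∀ r r', ‖γ r' - γ r‖ ≤ β * dist r r') ∧ γ ⟨0, le_rfl, hT⟩ ∈ K}

theorem isCompact_lipschitzPaths [ProperSpace E] {β : ℝ} (hβ : 0 ≤ β) (hT : 0 ≤ T) {K : Set E}
    (hK : IsCompact K) : IsCompact (lipschitzPaths T β hT K) := by
  refine BoundedContinuousFunction.arzela_ascoli₂ (Metric.cthickening (β * T) K) hK.cthickening _
    ?_ ?_ ?_
  · refine IsClosed.inter ?_ ?_
    · have : {γ : Set.Icc (0 : ℝ) T →ᵇ E | ∀ r r', ‖γ r' - γ r‖ ≤ β * dist r r'} =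
          ⋂ r, ⋂ r', {γ : Set.Icc (0 : ℝ) T →ᵇ E | ‖γ r' - γ r‖ ≤ β * dist r r'} := by
        ext; simp only [Set.mem_ofPred_eq, Set.mem_iInter]
      change IsClosed {γ : Set.Icc (0 : ℝ) T →ᵇ E | ∀ r r', ‖γ r' - γ r‖ ≤ β * dist r r'}
      rw [this]
      refine isClosed_iInter fun r => isClosed_iInter fun r' => isClosed_le ?_ continuous_const
      exact ((continuous_eval_const _).sub (continuous_eval_const _)).norm
    · exact hK.isClosed.preimage (continuous_eval_const _)
  · intro γ r hγ
    refine Metric.mem_cthickening_of_dist_le _ _ _ _ hγ.2 ?_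
    rw [dist_eq_norm]
    refine (hγ.1 _ _).trans ?_
    gcongr
    rw [Subtype.dist_eq, Real.dist_eq, abs_sub_comm, abs_of_nonneg (by simpa using r.2.1)]
    simpa using r.2.2
  · refine LipschitzWith.uniformEquicontinuous _ β.toNNReal (fun γ => ?_) |>.equicontinuous
    refine LipschitzWith.of_dist_le_mul fun r r' => ?_
    rw [dist_comm, dist_eq_norm, Real.coe_toNNReal _ hβ]
    exact γ.2.1 r r'

variable {b : E → ℝ → ℝ} {α β : ℝ}

theorem IsSpeed.continuous_comp_extend (hb : IsSpeed b α β) (hT : 0 ≤ T)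
    (γ : Set.Icc (0 : ℝ) T →ᵇ E) : Continuous fun u => b (Set.IccExtend hT γ u) u := by
  have h : Continuous fun u => (Set.IccExtend hT γ u, u) :=
    (γ.continuous.Icc_extend' (h := hT)).prodMk continuous_id
  exact hb.continuous.comp h

/-- The absolute value in `speedExcess` makes the constraint symmetric in the two times, so no
ordering of the pair is required. -/
theorem isSpeedPath_extend_iff (hb : IsSpeed b α β) (hT : 0 ≤ T) (γ : Set.Icc (0 : ℝ) T →ᵇ E) :
    IsSpeedPath b 0 T (Set.IccExtend hT γ) ↔ ∀ r, speedExcess b hT γ r ≤ 0 := by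
  have hc : ContinuousOn (Set.IccExtend hT γ) (Set.Icc 0 T) :=
    (γ.continuous.Icc_extend' (h := hT)).continuousOn
  have hnn : ∀ r r' : ℝ, 0 ≤ r → r ≤ r' → r' ≤ T →
      0 ≤ ∫ u in r..r', b (Set.IccExtend hT γ u) u := fun r r' h1 h2 h3 =>
    (mul_nonneg hb.pos.le (sub_nonneg.2 h2)).trans (hb.le_integral hc h1 h2 h3)
  constructor
  · rintro h ⟨r, r'⟩
    simp only [speedExcess, sub_nonpos]
    rcases le_total r r' with hr | hr
    · have := h.norm_sub_le r r' r.2.1 hr r'.2.2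
      rw [Set.IccExtend_val, Set.IccExtend_val] at this
      exact this.trans (le_abs_self _)
    · have := h.norm_sub_le r' r r'.2.1 hr r.2.2
      rw [Set.IccExtend_val, Set.IccExtend_val] at this
      rw [intervalIntegral.integral_symm, abs_neg, norm_sub_rev]
      exact this.trans (le_abs_self _)
  · refine fun h => ⟨hc, fun r r' h1 h2 h3 => ?_⟩
    have hr : r ∈ Set.Icc 0 T := ⟨h1, h2.trans h3⟩
    have hr' : r' ∈ Set.Icc 0 T := ⟨h1.trans h2, h3⟩
    have := h (⟨r, hr⟩, ⟨r', hr'⟩)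
    rw [speedExcess, sub_nonpos, abs_of_nonneg (hnn r r' h1 h2 h3)] at this
    rwa [Set.IccExtend_of_mem _ _ hr, Set.IccExtend_of_mem _ _ hr']

theorem continuous_speedExcess (hb : IsSpeed b α β) (hT : 0 ≤ T) (γ : Set.Icc (0 : ℝ) T →ᵇ E) :
    Continuous (speedExcess b hT γ) := by
  have hc := hb.continuous_comp_extend hT γ
  have hp : Continuous fun r => ∫ u in (0 : ℝ)..r, b (Set.IccExtend hT γ u) u :=
    intervalIntegral.continuous_primitive (fun _ _ => hc.intervalIntegrable _ _) _
  have : speedExcess b hT γ = fun r : Set.Icc (0 : ℝ) T × Set.Icc (0 : ℝ) T =>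
      ‖γ r.2 - γ r.1‖ - |(∫ u in (0 : ℝ)..r.2, b (Set.IccExtend hT γ u) u) -
        ∫ u in (0 : ℝ)..r.1, b (Set.IccExtend hT γ u) u| := by
    ext r
    rw [speedExcess, intervalIntegral.integral_interval_sub_left] <;>
      exact hc.intervalIntegrable _ _
  rw [this]
  have h1 := γ.continuous
  exact ((h1.comp continuous_snd).sub (h1.comp continuous_fst)).norm.sub
    ((hp.comp (continuous_subtype_val.comp continuous_snd)).sub
      (hp.comp (continuous_subtype_val.comp continuous_fst))).abs

theorem speedExcess_sub_le (hb : IsSpeed b α β) {L : ℝ} (hL0 : 0 ≤ L)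
    (hL : ∀ x y t, |b x t - b y t| ≤ L * ‖x - y‖) (hT : 0 ≤ T)
    (γ γ' : Set.Icc (0 : ℝ) T →ᵇ E) (r : Set.Icc (0 : ℝ) T × Set.Icc (0 : ℝ) T) :
    speedExcess b hT γ r - speedExcess b hT γ' r ≤ (2 + L * T) * dist γ γ' := by
  set I := ∫ u in (r.1 : ℝ)..r.2, b (Set.IccExtend hT γ u) u
  set I' := ∫ u in (r.1 : ℝ)..r.2, b (Set.IccExtend hT γ' u) u
  have hd : ∀ q, ‖γ q - γ' q‖ ≤ dist γ γ' := fun q => by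
    rw [← dist_eq_norm]; exact BoundedContinuousFunction.dist_coe_le_dist q
  have h1 : ‖γ r.2 - γ r.1‖ - ‖γ' r.2 - γ' r.1‖ ≤ 2 * dist γ γ' := by
    refine (norm_sub_norm_le _ _).trans ?_
    rw [sub_sub_sub_comm]
    exact (norm_sub_le _ _).trans (by linarith [hd r.1, hd r.2])
  have h2 : |I' - I| ≤ L * T * dist γ γ' := by
    have : I' - I = ∫ u in (r.1 : ℝ)..r.2,
        (b (Set.IccExtend hT γ' u) u - b (Set.IccExtend hT γ u) u) :=
      (intervalIntegral.integral_sub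
        ((hb.continuous_comp_extend hT γ').intervalIntegrable _ _)
        ((hb.continuous_comp_extend hT γ).intervalIntegrable _ _)).symm
    rw [this, ← Real.norm_eq_abs]
    refine (intervalIntegral.norm_integral_le_of_norm_le_const
      (C := L * dist γ γ') fun u _ => ?_).trans ?_
    · rw [Real.norm_eq_abs, abs_sub_comm]
      refine (hL _ _ _).trans ?_
      gcongr
      exact hd _
    · have h3 : |(r.2 : ℝ) - r.1| ≤ T := by
        rw [abs_le]
        constructor <;> linarith [r.1.2.1, r.1.2.2, r.2.2.1, r.2.2.2]
      calc _ ≤ L * dist γ γ' * T := by gcongr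
        _ = _ := by ring
  have h4 : |I'| - |I| ≤ |I' - I| := abs_sub_abs_le_abs_sub _ _
  simp only [speedExcess]
  linarith

theorem IsSpeedPath.exists_mem_lipschitzPaths {K : Set E} (hb : IsSpeed b α β) (hT : 0 ≤ T)
    {γ : ℝ → E} (h : IsSpeedPath b 0 T γ) (hK : γ 0 ∈ K) :
    ∃ γ' ∈ lipschitzPaths T β hT K, (∀ r, speedExcess b hT γ' r ≤ 0) ∧
      ∀ r : Set.Icc (0 : ℝ) T, γ' r = γ r := by
  let c : C(Set.Icc (0 : ℝ) T, E) :=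
    ⟨fun r => γ r, continuousOn_iff_continuous_domRestrict.1 h.continuousOn⟩
  refine ⟨BoundedContinuousFunction.mkOfCompact c, ⟨fun r r' => ?_, hK⟩, ?_, fun _ => rfl⟩
  · have := (h.lipschitzOnWith hb).dist_le_mul r r.2 r' r'.2
    rw [Real.coe_toNNReal _ hb.pos_upper.le, dist_comm, dist_eq_norm] at this
    exact this
  · rw [← isSpeedPath_extend_iff hb hT]
    exact h.congr fun r hr => Set.IccExtend_of_mem hT _ hr

/-- Speed paths from `x` form a closed subset of an Arzelà–Ascoli compact set, and evaluation at the
final time is continuous. -/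
theorem isCompact_reach [ProperSpace E] (hb : IsSpeed b α β) {L : ℝ} (hL0 : 0 ≤ L)
    (hL : ∀ x y t, |b x t - b y t| ≤ L * ‖x - y‖) (hT : 0 ≤ T) (x : E) :
    IsCompact (reach b 0 T x) := by
  have hclosed : IsClosed {γ : Set.Icc (0 : ℝ) T →ᵇ E | ∀ r, speedExcess b hT γ r ≤ 0} := by
    have : {γ : Set.Icc (0 : ℝ) T →ᵇ E | ∀ r, speedExcess b hT γ r ≤ 0} =
        ⋂ r, {γ : Set.Icc (0 : ℝ) T →ᵇ E | speedExcess b hT γ r ≤ 0} := by ext; simp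
    rw [this]
    refine isClosed_iInter fun r => isClosed_le ?_ continuous_const
    refine (LipschitzWith.of_le_add_mul (2 + L * T).toNNReal fun γ γ' => ?_).continuous
    rw [Real.coe_toNNReal _ (by positivity)]
    linarith [speedExcess_sub_le hb hL0 hL hT γ γ' r]
  have h := ((isCompact_lipschitzPaths hb.pos_upper.le hT (isCompact_singleton (x := x))).inter_right
    hclosed).image (continuous_eval_const (⟨T, hT, le_rfl⟩ : Set.Icc (0 : ℝ) T))
  convert h using 1
  ext y
  constructor
  · rintro ⟨γ, hγ, h0, h1⟩
    obtain ⟨γ', h2, h3, h4⟩ := hγ.exists_mem_lipschitzPaths hb hT (K := {x}) h0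
    exact ⟨γ', ⟨h2, h3⟩, (h4 _).trans h1⟩
  · rintro ⟨γ, ⟨h2, h3⟩, h4⟩
    exact ⟨_, (isSpeedPath_extend_iff hb hT γ).2 h3, (Set.IccExtend_of_mem hT γ _).trans h2.2,
      (Set.IccExtend_of_mem hT γ _).trans h4⟩

end PathSpace

/-- The support exceeds `c` exactly when, for some rational `q > c`, a speed path has inner product
at least `q`. Periodicity moves its start into the unit cell, so the candidates `Γ q` form a compact
set independent of `ω`. -/
theorem measurable_displacementSupport {n : ℕ} {Ω : Type*} [MeasurableSpace Ω] {α β T : ℝ}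
    {a : EuclideanSpace ℝ (Fin n) → ℝ → Ω → ℝ}
    (hm : Measurable fun p : (EuclideanSpace ℝ (Fin n) × ℝ) × Ω => a p.1.1 p.1.2 p.2)
    (hb : ∀ ω, IsSpeed (fun x r => a x r ω) α β)
    (hL : ∀ ω, ∃ L : ℝ, 0 ≤ L ∧ ∀ x y t, |a x t ω - a y t ω| ≤ L * ‖x - y‖)
    (hper : ∀ x l t ω, a (x + intVec l) t ω = a x t ω) (hT : 0 ≤ T)
    (p : EuclideanSpace ℝ (Fin n)) :
    Measurable fun ω => displacementSupport (fun x r => a x r ω) 0 T p := by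
  rcases isEmpty_or_nonempty Ω with hΩ | ⟨⟨ω₀⟩⟩
  · exact measurable_of_empty _
  have hβ := (hb ω₀).pos_upper.le
  let e₀ : Set.Icc (0 : ℝ) T := ⟨0, le_rfl, hT⟩
  let e₁ : Set.Icc (0 : ℝ) T := ⟨T, hT, le_rfl⟩
  let Γ : ℚ → Set (Set.Icc (0 : ℝ) T →ᵇ EuclideanSpace ℝ (Fin n)) := fun q =>
    lipschitzPaths T β hT (unitCell n) ∩ {γ | (q : ℝ) ≤ inner ℝ p (γ e₁ - γ e₀)}
  have hΓ : ∀ q, IsCompact (Γ q) := fun q =>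
    (isCompact_lipschitzPaths hβ hT (isCompact_unitCell n)).inter_right
      (isClosed_le continuous_const (continuous_const.inner
        ((continuous_eval_const _).sub (continuous_eval_const _))))
  have hmeas : ∀ q, MeasurableSet
      {ω | ∃ γ ∈ Γ q, ∀ r, speedExcess (fun x r => a x r ω) hT γ r ≤ 0} := by
    refine fun q => (hΓ q).measurableSet_exists_forall_le_zero (fun γ r => ?_) (fun ω => ?_)
      fun ω γ => continuous_speedExcess (hb ω) hT γ
    · have hint : StronglyMeasurable (Function.uncurry fun (ω : Ω) (u : ℝ) =>
          a (Set.IccExtend hT γ u) u ω) := by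
        have hγ : Measurable (Set.IccExtend hT γ) :=
          (γ.continuous.Icc_extend' (h := hT)).measurable
        refine Measurable.stronglyMeasurable ?_
        exact hm.comp (f := fun q : Ω × ℝ => ((Set.IccExtend hT γ q.2, q.2), q.1))
          (by fun_prop)
      simp only [speedExcess, intervalIntegral]
      exact measurable_const.sub (continuous_abs.measurable.comp
        (hint.integral_prod_right.measurable.sub hint.integral_prod_right.measurable))
    · obtain ⟨L, hL0, hL⟩ := hL ω
      exact ⟨_, fun γ γ' r => speedExcess_sub_le (hb ω) hL0 hL hT γ γ' r⟩
  refine measurable_of_Ioi fun c => ?_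
  have key : (fun ω => displacementSupport (fun x r => a x r ω) 0 T p) ⁻¹' Set.Ioi c =
      ⋃ q : ℚ, ⋃ _ : c < q,
        {ω | ∃ γ ∈ Γ q, ∀ r, speedExcess (fun x r => a x r ω) hT γ r ≤ 0} := by
    ext ω
    simp only [Set.mem_preimage, Set.mem_Ioi, Set.mem_iUnion, Set.mem_ofPred_eq, exists_prop]
    constructor
    · intro h
      obtain ⟨v, ⟨x, hx⟩, hv⟩ := exists_lt_inner_of_lt_displacementSupport (hb ω) hT h
      obtain ⟨q, hq, hqv⟩ := exists_rat_btwn hv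
      obtain ⟨l, hl⟩ := exists_intVec_sub_mem_unitCell x
      have hneg : -intVec l = intVec (-l) := by ext i; simp [intVec]
      obtain ⟨γ, hγ, h0, h1⟩ := add_mem_reach_add (l := -intVec l)
        (fun x t => by rw [hneg]; exact hper x (-l) t ω) hx
      obtain ⟨γ', h2, h3, h4⟩ := hγ.exists_mem_lipschitzPaths (hb ω) hT (K := unitCell n)
        (by rw [h0, ← sub_eq_add_neg]; exact hl)
      refine ⟨q, hq, γ', ⟨h2, ?_⟩, h3⟩
      have e : γ' e₁ - γ' e₀ = v := by
        rw [h4, h4]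
        change γ T - γ 0 = v
        rw [h0, h1]
        abel
      change (q : ℝ) ≤ inner ℝ p (γ' e₁ - γ' e₀)
      rw [e]
      exact hqv.le
    · rintro ⟨q, hq, γ, ⟨h2, h3⟩, h4⟩
      refine hq.trans_le (le_trans h3 (inner_le_displacementSupport (hb ω) hT p ⟨γ e₀, ?_⟩))
      rw [add_sub_cancel]
      exact ⟨_, (isSpeedPath_extend_iff (hb ω) hT γ).2 h4, Set.IccExtend_of_mem hT γ _,
        Set.IccExtend_of_mem hT γ _⟩
  rw [key]
  exact .iUnion fun q => .iUnion fun _ => hmeas q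

/-! ### Existence of the limiting support function -/

/-- With `S` the partial sums of `g`, both sides are `S (m + k) - S m - S k`. -/
theorem Finset.sum_range_add_sub {M : Type*} [AddCommGroup M] (g : ℕ → M) (m k : ℕ) :
    ∑ j ∈ Finset.range m, (g (j + k) - g j) = ∑ i ∈ Finset.range k, (g (m + i) - g i) := by
  have h1 := Finset.sum_range_add g m k
  have h2 := Finset.sum_range_add g k m
  rw [add_comm k m, h1] at h2
  have h3 : ∑ j ∈ Finset.range m, g (j + k) = ∑ j ∈ Finset.range m, g (k + j) :=
    Finset.sum_congr rfl fun j _ => by rw [add_comm]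
  rw [Finset.sum_sub_distrib, Finset.sum_sub_distrib, sub_eq_sub_iff_add_eq_add, h3, add_comm,
    ← h2, add_comm]

/-- A sequence whose increments `g (j + N) - g j` agree, up to a bounded error, with quantities
`F N j` having Cesàro averages is asymptotically linear. -/
theorem exists_tendsto_div_of_almost_additive {g : ℕ → ℝ} {F : ℕ → ℕ → ℝ} {e : ℕ → ℝ} {B C : ℝ}
    (hB : 0 ≤ B) (hF0 : ∀ N j, 0 ≤ F N j) (hF : ∀ N j, F N j ≤ B * N)
    (hg0 : g 0 = 0) (hg : ∀ N j, |F N j - (g (j + N) - g j)| ≤ C)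
    (he : ∀ N, Tendsto (fun M : ℕ => (M : ℝ)⁻¹ * ∑ j ∈ Finset.range M, F N j) atTop (𝓝 (e N))) :
    ∃ l, Tendsto (fun N : ℕ => (N : ℝ)⁻¹ * e N) atTop (𝓝 l) ∧
      Tendsto (fun M : ℕ => (M : ℝ)⁻¹ * g M) atTop (𝓝 l) := by
  have hinc : ∀ N j, |g (j + N) - g j| ≤ B * N + C := fun N j => by
    have h1 := abs_le.1 (hg N j)
    rw [abs_le]
    constructor <;> nlinarith [hF N j, hF0 N j, (Nat.cast_nonneg N : (0 : ℝ) ≤ N)]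
  -- Telescoping turns `M` increments of length `N` into `N` differences `g (M + i) - g i`, each
  -- equal to `g M` up to an error independent of `M`.
  have hmain : ∀ N M : ℕ, |N * g M - ∑ j ∈ Finset.range M, F N j| ≤
      M * C + N * (2 * (B * N + C)) := by
    intro N M
    have h1 : |∑ j ∈ Finset.range M, (F N j - (g (j + N) - g j))| ≤ M * C := by
      refine (Finset.abs_sum_le_sum_abs _ _).trans ?_
      simpa using Finset.sum_le_card_nsmul (Finset.range M) _ C fun j _ => hg N j
    have h2 : |∑ i ∈ Finset.range N, ((g (M + i) - g i) - g M)| ≤ N * (2 * (B * N + C)) := by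
      refine (Finset.abs_sum_le_sum_abs _ _).trans ?_
      refine (Finset.sum_le_card_nsmul (Finset.range N) _ (2 * (B * N + C)) fun i hi => ?_).trans
        (by simp)
      have hiN : (i : ℝ) ≤ N := by exact_mod_cast (Finset.mem_range.1 hi).le
      have a1 := abs_le.1 (hinc i M)
      have a2 := abs_le.1 (hinc i 0)
      rw [zero_add, hg0, sub_zero] at a2
      have a3 : B * i ≤ B * N := by gcongr
      rw [abs_le]
      constructor <;> linarith
    rw [Finset.sum_sub_distrib, Finset.sum_range_add_sub] at h1
    rw [Finset.sum_sub_distrib, Finset.sum_const, Finset.card_range, nsmul_eq_mul] at h2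
    have a1 := abs_le.1 h1
    have a2 := abs_le.1 h2
    rw [abs_le]
    constructor <;> linarith
  -- In `C + 2`, one unit absorbs the boundary term divided by `M`, the other the error in the
  -- Cesàro limit.
  have hclose : ∀ N : ℕ, 0 < N → ∀ᶠ M : ℕ in atTop,
      |(M : ℝ)⁻¹ * g M - (N : ℝ)⁻¹ * e N| ≤ (C + 2) * (N : ℝ)⁻¹ := by
    intro N hN
    have hN' : (0 : ℝ) < N := by exact_mod_cast hN
    have h1 := Metric.tendsto_nhds.1 (he N) 1 one_pos
    obtain ⟨K, hK⟩ := exists_nat_gt (N * (2 * (B * N + C)))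
    filter_upwards [h1, eventually_ge_atTop K, eventually_gt_atTop 0] with M hM1 hM2 hM3
    have hM' : (0 : ℝ) < M := by exact_mod_cast hM3
    have hKM : (K : ℝ) ≤ M := by exact_mod_cast hM2
    rw [Real.dist_eq] at hM1
    have h2 : |(M : ℝ)⁻¹ * (N * g M - ∑ j ∈ Finset.range M, F N j)| ≤ C + 1 := by
      rw [abs_mul, abs_of_pos (inv_pos.2 hM'), inv_mul_le_iff₀ hM']
      linarith [hmain N M]
    have h3 : |N * ((M : ℝ)⁻¹ * g M) - e N| ≤ C + 2 := by
      have a1 := abs_le.1 h2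
      have a2 := abs_lt.1 hM1
      rw [mul_sub] at a1
      have a3 : (M : ℝ)⁻¹ * (N * g M) = N * ((M : ℝ)⁻¹ * g M) := by ring
      rw [a3] at a1
      rw [abs_le]
      constructor <;> linarith
    have h4 : (M : ℝ)⁻¹ * g M - (N : ℝ)⁻¹ * e N =
        (N * ((M : ℝ)⁻¹ * g M) - e N) * (N : ℝ)⁻¹ := by
      field_simp
    rw [h4, abs_mul, abs_of_pos (inv_pos.2 hN')]
    gcongr
  have hsmall : Tendsto (fun N : ℕ => (C + 2) * (N : ℝ)⁻¹) atTop (𝓝 0) := by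
    simpa using tendsto_inv_atTop_nhds_zero_nat.const_mul (C + 2)
  have hcauchy : CauchySeq fun M : ℕ => (M : ℝ)⁻¹ * g M := by
    rw [Metric.cauchySeq_iff']
    intro ε hε
    obtain ⟨N, hN1, hN2⟩ := ((hsmall.eventually_lt_const (half_pos hε)).and
      (eventually_gt_atTop 0)).exists
    obtain ⟨K, hK⟩ := eventually_atTop.1 (hclose N hN2)
    refine ⟨K, fun M hM => ?_⟩
    have a1 := abs_le.1 (hK M hM)
    have a2 := abs_le.1 (hK K le_rfl)
    rw [Real.dist_eq, abs_lt]
    constructor <;> linarith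
  obtain ⟨l, hl⟩ := cauchySeq_tendsto_of_complete hcauchy
  refine ⟨l, ?_, hl⟩
  rw [tendsto_iff_dist_tendsto_zero]
  refine squeeze_zero' (.of_forall fun _ => dist_nonneg) ?_ hsmall
  filter_upwards [eventually_gt_atTop 0] with N hN
  rw [dist_comm, Real.dist_eq]
  exact le_of_tendsto (hl.sub_const _).abs (hclose N hN)

/-! ### Ergodicity of the generator and the random speed. -/

theorem IsErgodicGroup.iterate_one {Ω : Type*} [MeasurableSpace Ω] {P : Measure Ω}
    {τ : ℤ → Ω → Ω} (hτ : IsErgodicGroup P τ) (k : ℕ) : (τ 1)^[k] = τ k := by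
  induction k with
  | zero => simp [hτ.zero]
  | succ k ih => rw [Function.iterate_succ, ih, ← hτ.add]; simp

/-- `Ergodic` tests preimages under one map, the hypothesis tests images under the whole group;
invertibility of each `τ k` reconciles them. -/
theorem IsErgodicGroup.ergodic_one {Ω : Type*} [MeasurableSpace Ω] {P : Measure Ω}
    [IsProbabilityMeasure P] {τ : ℤ → Ω → Ω} (hτ : IsErgodicGroup P τ) : Ergodic (τ 1) P where
  toMeasurePreserving := hτ.measurePreserving 1
  aeconst_set := by
    intro U hU hinv
    have hinj : ∀ k x, τ (-k) (τ k x) = x := fun k x => by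
      have := congrFun (hτ.add (-k) k) x
      simpa [hτ.zero] using this.symm
    have hinj' : ∀ k x, τ k (τ (-k) x) = x := fun k x => by
      simpa using hinj (-k) x
    have hmem : ∀ x, τ 1 x ∈ U ↔ x ∈ U := fun x => by
      rw [← Set.mem_preimage, hinv]
    have hnat : ∀ (k : ℕ) x, τ k x ∈ U ↔ x ∈ U := by
      intro k
      induction k with
      | zero => simp [hτ.zero]
      | succ k ih =>
        intro x
        have : τ ((k + 1 : ℕ) : ℤ) x = τ k (τ 1 x) := by
          rw [Nat.cast_succ, hτ.add]
          rfl
        rw [this, ih, hmem]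
    have hint : ∀ (k : ℤ) x, τ k x ∈ U ↔ x ∈ U := by
      intro k x
      obtain ⟨m, rfl | rfl⟩ := k.eq_nat_or_neg
      · exact hnat m x
      · rw [← hnat m (τ (-(m : ℤ)) x), hinj']
    have himage : ∀ k : ℤ, τ k '' U = U := by
      intro k
      ext x
      constructor
      · rintro ⟨y, hy, rfl⟩
        exact (hint k y).2 hy
      · exact fun hx => ⟨τ (-k) x, (hint _ x).2 hx, hinj' k x⟩
    rw [eventuallyConst_set']
    rcases hτ.ergodic U hU himage with h | h
    · right
      exact eventuallyEq_univ.2 ((mem_ae_iff_prob_eq_one hU).2 h)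
    · left
      exact ae_eq_empty.2 h

/-- A continuous family of random speeds as in `VelocityAssumption`, with explicit bounds. -/
structure IsRandomSpeed {n : ℕ} {Ω : Type*} [MeasurableSpace Ω] (τ : ℤ → Ω → Ω)
    (a : EuclideanSpace ℝ (Fin n) → ℝ → Ω → ℝ) (α β : ℝ) : Prop where
  measurable : Measurable fun p : (EuclideanSpace ℝ (Fin n) × ℝ) × Ω => a p.1.1 p.1.2 p.2
  isSpeed : ∀ ω, IsSpeed (fun x r => a x r ω) α β
  lipschitz : ∀ ω, ∃ L : ℝ, 0 ≤ L ∧ ∀ x y t, |a x t ω - a y t ω| ≤ L * ‖x - y‖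
  periodic : ∀ x l t ω, a (x + intVec l) t ω = a x t ω
  stationary : ∀ x t k ω, a x t (τ k ω) = a x (t + (k : ℤ)) ω

theorem VelocityAssumption.exists_isRandomSpeed {n : ℕ} {Ω : Type*} [MeasurableSpace Ω]
    {P : Measure Ω} {τ : ℤ → Ω → Ω} (hτ : IsErgodicGroup P τ)
    {a : EuclideanSpace ℝ (Fin n) → ℝ → Ω → ℝ} (ha : VelocityAssumption τ a) :
    ∃ α β, IsRandomSpeed τ a α β := by
  obtain ⟨α, β, hα, -, hab⟩ := ha.bounds
  refine ⟨α, β, ha.measurable, fun ω => ⟨?_, hα, fun x t => (hab x t ω).1,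
    fun x t => (hab x t ω).2⟩, fun ω => ?_, fun x l t ω => ?_, fun x t k ω => ?_⟩
  · obtain ⟨K, hK⟩ := ha.lipschitz ω
    exact hK.continuous
  · obtain ⟨K, hK⟩ := ha.lipschitz ω
    refine ⟨K, K.2, fun x y t => ?_⟩
    have := hK.dist_le_mul (x, t) (y, t)
    rwa [Real.dist_eq, Prod.dist_eq, dist_self, max_eq_left dist_nonneg, dist_eq_norm] at this
  · have := ha.periodic_stationary x l t 0 ω
    rw [hτ.zero] at this
    simpa [intVec] using this
  · have := ha.periodic_stationary x 0 t k ω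
    rw [← this]
    congr 1
    ext i
    simp

section Limit

variable {n : ℕ} {Ω : Type*} [MeasurableSpace Ω] {P : Measure Ω} [IsProbabilityMeasure P]
  {τ : ℤ → Ω → Ω} {a : EuclideanSpace ℝ (Fin n) → ℝ → Ω → ℝ} {α β : ℝ}

theorem displacementSupport_zero_eq_zero {E : Type*} [NormedAddCommGroup E]
    [InnerProductSpace ℝ E] {b : E → ℝ → ℝ} (hb : IsSpeed b α β) (p : E) (s : ℝ) :
    displacementSupport b s s p = 0 :=
  le_antisymm (by simpa using displacementSupport_le_mul_norm (p := p) hb (le_refl s))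
    (displacementSupport_nonneg hb le_rfl)

theorem exists_ae_tendsto_displacementSupport (hτ : IsErgodicGroup P τ)
    (ha : IsRandomSpeed τ a α β) (p : EuclideanSpace ℝ (Fin n)) :
    ∃ l, ∀ᵐ ω ∂P, Tendsto
      (fun M : ℕ => (M : ℝ)⁻¹ * displacementSupport (fun x r => a x r ω) 0 M p) atTop (𝓝 l) := by
  let H : Ω → ℝ → ℝ → ℝ := fun ω s t => displacementSupport (fun x r => a x r ω) s t p
  have hmeas : ∀ N : ℕ, Measurable fun ω => H ω 0 N := fun N =>
    measurable_displacementSupport ha.measurable ha.isSpeed ha.lipschitz ha.periodic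
      N.cast_nonneg p
  have hnn : ∀ ω s t, s ≤ t → 0 ≤ H ω s t := fun ω s t h =>
    displacementSupport_nonneg (ha.isSpeed ω) h
  have hle : ∀ ω s t, s ≤ t → H ω s t ≤ β * (t - s) * ‖p‖ := fun ω s t h =>
    displacementSupport_le_mul_norm (ha.isSpeed ω) h
  have hbd : ∀ (N : ℕ) ω, |H ω 0 N| ≤ β * N * ‖p‖ := fun N ω => by
    rw [abs_of_nonneg (hnn ω _ _ N.cast_nonneg)]
    simpa using hle ω 0 N N.cast_nonneg
  have hshift : ∀ (N k : ℕ) ω, H ((τ 1)^[k] ω) 0 N = H ω k ((k + N : ℕ) : ℝ) := by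
    intro N k ω
    simp only [H, hτ.iterate_one, ha.stationary]
    exact (displacementSupport_comp_add (b := fun x r => a x r ω) ((k : ℤ) : ℝ)).trans
      (by simp [add_comm])
  have hae : ∀ᵐ ω ∂P, ∀ N : ℕ, Tendsto
      (fun M : ℕ => (M : ℝ)⁻¹ * ∑ j ∈ Finset.range M, H ω j ((j + N : ℕ) : ℝ)) atTop
      (𝓝 (∫ ω, H ω 0 N ∂P)) := by
    refine ae_all_iff.2 fun N => ?_
    filter_upwards [hτ.ergodic_one.ae_tendsto_birkhoffSum (hmeas N) (hbd N)] with ω hω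
    simpa only [birkhoffSum, hshift] using hω
  have hmain : ∀ᵐ ω ∂P, ∃ l,
      Tendsto (fun N : ℕ => (N : ℝ)⁻¹ * ∫ ω, H ω 0 N ∂P) atTop (𝓝 l) ∧
      Tendsto (fun M : ℕ => (M : ℝ)⁻¹ * H ω 0 M) atTop (𝓝 l) := by
    filter_upwards [hae] with ω hω
    have hb := ha.isSpeed ω
    have hβ := hb.pos_upper.le
    have hα := hb.pos.le
    have hmem := hasMemoryBound_of_periodic hb fun x l t => ha.periodic x l t ω
    refine exists_tendsto_div_of_almost_additive (F := fun N j => H ω j ((j + N : ℕ) : ℝ))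
      (B := β * ‖p‖) (C := (√n + β * (√n / α)) * ‖p‖) (by positivity)
      (fun N j => hnn ω _ _ (by simp)) (fun N j => ?_) ?_ (fun N j => ?_) hω
    · refine (hle ω _ _ (by simp)).trans_eq ?_
      push_cast
      ring
    · simp only [H, Nat.cast_zero]
      exact displacementSupport_zero_eq_zero hb p 0
    · have hj : (0 : ℝ) ≤ j := j.cast_nonneg
      have hjN : (j : ℝ) ≤ ((j + N : ℕ) : ℝ) := by simp
      have h1 := displacementSupport_le_add (p := p) hb hj hjN
      have h2 := add_le_displacementSupport (p := p) hb hmem hj hjN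
      have h3 : 0 ≤ (√n + β * (√n / α)) * ‖p‖ := by positivity
      simp only [H]
      rw [abs_le]
      constructor <;> linarith
  -- The limit is deterministic because it is also the limit of `N⁻¹ * ∫ H(0,N)`, which does not
  -- involve `ω`.
  obtain ⟨ω₀, l, hl, -⟩ := hmain.exists
  refine ⟨l, ?_⟩
  filter_upwards [hmain] with ω ⟨l', h1, h2⟩
  rwa [tendsto_nhds_unique hl h1]

end Limit

/-- Pointwise convergence of uniformly Lipschitz functions on a dense set is uniform on compact
sets. -/
theorem eventually_forall_abs_sub_le_of_dense {E : Type*} [PseudoMetricSpace E] {ι : Type*}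
    {l : Filter ι} {f : ι → E → ℝ} {h : E → ℝ} {B : ℝ} (hf : ∀ i p q, f i p - f i q ≤ B * dist p q)
    (hh : ∀ p q, h p - h q ≤ B * dist p q) {Q K : Set E} (hQ : Dense Q) (hK : IsCompact K)
    (hlim : ∀ q ∈ Q, Tendsto (fun i => f i q) l (𝓝 (h q))) {ε : ℝ} (hε : 0 < ε) :
    ∀ᶠ i in l, ∀ p ∈ K, |f i p - h p| ≤ ε := by
  have hδ : 0 < ε / (4 * (|B| + 1)) := by positivity
  obtain ⟨Q', hQ'Q, hfin, hcov⟩ := hK.elim_finite_subcover_image (b := Q)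
    (c := fun q => Metric.ball q (ε / (4 * (|B| + 1)))) (fun _ _ => Metric.isOpen_ball)
    (fun p _ => by
      obtain ⟨q, hq, hpq⟩ := hQ.exists_dist_lt p hδ
      exact Set.mem_biUnion hq hpq)
  have h1 : ∀ᶠ i in l, ∀ q ∈ Q', dist (f i q) (h q) < ε / 2 :=
    (hfin.eventually_all).2 fun q hq => Metric.tendsto_nhds.1 (hlim q (hQ'Q hq)) _ (half_pos hε)
  filter_upwards [h1] with i hi p hp
  obtain ⟨q, hq, hpq⟩ := Set.mem_iUnion₂.1 (hcov hp)
  have a1 := abs_lt.1 (hi q hq)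
  rw [Metric.mem_ball, lt_div_iff₀ (by positivity)] at hpq
  have a2 : B * dist p q ≤ ε / 4 := by
    nlinarith [le_abs_self B, dist_nonneg (x := p) (y := q)]
  have a3 := hf i p q
  have a4 := hf i q p
  have a5 := hh p q
  have a6 := hh q p
  rw [dist_comm] at a4 a6
  rw [abs_le]
  constructor <;> linarith

/-- The support functions of the displacements on `[0, t]` are asymptotic to `t • h`, uniformly
with respect to the direction. -/
def HasLimitSupport {E : Type*} [NormedAddCommGroup E] [InnerProductSpace ℝ E] (b : E → ℝ → ℝ)
    (h : E → ℝ) : Prop :=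
  ∀ ε > 0, ∃ T₀ > 0, ∀ T ≥ T₀, ∀ p, |displacementSupport b 0 T p - T * h p| ≤ ε * T * ‖p‖

/-- The properties of support functions of convex sets contained in the ball of radius `β`. -/
structure IsSupportFunction {E : Type*} [NormedAddCommGroup E] [NormedSpace ℝ E] (h : E → ℝ)
    (β : ℝ) : Prop where
  add_le : ∀ p q, h (p + q) ≤ h p + h q
  smul : ∀ c p, 0 ≤ c → h (c • p) = c * h p
  nonneg : ∀ p, 0 ≤ h p
  le : ∀ p, h p ≤ β * ‖p‖

theorem hasLimitSupport_of_tendsto {E : Type*} [NormedAddCommGroup E] [InnerProductSpace ℝ E]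
    [ProperSpace E] {b : E → ℝ → ℝ} {α β C : ℝ} {h : E → ℝ} (hb : IsSpeed b α β) (hC0 : 0 ≤ C)
    (hC : HasMemoryBound b C) (hh : IsSupportFunction h β) {Q : Set E} (hQ : Dense Q)
    (hlim : ∀ q ∈ Q, Tendsto (fun M : ℕ => (M : ℝ)⁻¹ * displacementSupport b 0 M q) atTop
      (𝓝 (h q))) : HasLimitSupport b h := by
  have hβ := hb.pos_upper
  intro ε hε
  have hev := eventually_forall_abs_sub_le_of_dense (B := β) (fun (M : ℕ) p q => ?_)
    (fun p q => ?_) hQ (isCompact_closedBall (0 : E) 1) hlim (half_pos hε)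
  · obtain ⟨M₀, hM₀⟩ := eventually_atTop.1 hev
    -- Replacing `T` by `⌊T⌋₊` costs at most `(2 * β + C) * ‖p‖`, which the second threshold absorbs
    -- into half of the error; the first ensures `⌊T⌋₊ ≥ M₀` and `⌊T⌋₊ > 0`.
    refine ⟨max (M₀ + 1) ((2 * β + C) / (ε / 2)), lt_max_of_lt_left (by positivity),
      fun T hT p => ?_⟩
    have hT1 : (M₀ : ℝ) + 1 ≤ T := (le_max_left _ _).trans hT
    have hT2 : (2 * β + C) ≤ T * (ε / 2) := by
      rw [← div_le_iff₀ (half_pos hε)]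
      exact (le_max_right _ _).trans hT
    have hT0 : 0 ≤ T := by linarith [(Nat.cast_nonneg M₀ : (0 : ℝ) ≤ M₀)]
    set M := ⌊T⌋₊
    have hMT : (M : ℝ) ≤ T := Nat.floor_le hT0
    have hTM : T < M + 1 := Nat.lt_floor_add_one T
    have hM0 : M₀ ≤ M := Nat.le_floor (by linarith)
    have hMpos : (0 : ℝ) < M := by linarith [(Nat.cast_nonneg M₀ : (0 : ℝ) ≤ M₀)]
    have hp0 := norm_nonneg p
    have h1 : |displacementSupport b 0 M p - M * h p| ≤ ε / 2 * M * ‖p‖ := by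
      rcases hp0.eq_or_lt with h0 | h0
      · have : p = 0 := norm_eq_zero.1 h0.symm
        subst this
        have e1 : displacementSupport b 0 M (0 : E) = 0 := by
          simpa using displacementSupport_smul (b := b) (s := 0) (t := M) (p := (0 : E)) le_rfl
        have e2 : h 0 = 0 := by simpa using hh.smul 0 0 le_rfl
        simp [e1, e2]
      · have h2 := hM₀ M hM0 (‖p‖⁻¹ • p) (by
          rw [mem_closedBall_zero_iff, norm_smul, norm_inv, norm_norm, inv_mul_cancel₀ h0.ne'])
        rw [displacementSupport_smul (inv_nonneg.2 hp0), hh.smul _ _ (inv_nonneg.2 hp0)] at h2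
        have e : displacementSupport b 0 M p - M * h p = ((M : ℝ)⁻¹ *
            (‖p‖⁻¹ * displacementSupport b 0 M p) - ‖p‖⁻¹ * h p) * (M * ‖p‖) := by
          field_simp
        rw [e, abs_mul, abs_of_pos (by positivity : 0 < (M : ℝ) * ‖p‖), mul_assoc (ε / 2)]
        gcongr
    have a1 := abs_le.1 h1
    have a2 := displacementSupport_le_add (p := p) hb hMpos.le hMT
    have a3 := add_le_displacementSupport (p := p) hb hC hMpos.le hMT
    have a4 := displacementSupport_nonneg (p := p) hb hMT
    have a5 := displacementSupport_le_mul_norm (p := p) hb hMT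
    have a6 : β * (T - M) * ‖p‖ ≤ β * ‖p‖ := by
      gcongr
      exact mul_le_of_le_one_right hβ.le (by linarith)
    have a7 : (T - M) * h p ≤ β * ‖p‖ := by
      nlinarith [hh.nonneg p, hh.le p]
    have a8 : 0 ≤ (T - M) * h p := mul_nonneg (sub_nonneg.2 hMT) (hh.nonneg p)
    have a9 : ε / 2 * M * ‖p‖ ≤ ε / 2 * T * ‖p‖ := by gcongr
    have a10 : (2 * β + C) * ‖p‖ ≤ T * (ε / 2) * ‖p‖ := by gcongr
    have a11 : 0 ≤ β * ‖p‖ := by positivity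
    have a12 : 0 ≤ C * ‖p‖ := by positivity
    rw [abs_le]
    constructor <;> linarith
  · have h1 := displacementSupport_sub_le (p := p) (q := q) hb M.cast_nonneg
    rw [sub_zero, ← dist_eq_norm] at h1
    rcases M.eq_zero_or_pos with rfl | hM
    · simpa using mul_nonneg hβ.le dist_nonneg
    · have hM' : (0 : ℝ) < M := by exact_mod_cast hM
      rw [← mul_sub, inv_mul_le_iff₀ hM']
      linarith
  · have h1 := hh.add_le (p - q) q
    have h2 := hh.le (p - q)
    rw [sub_add_cancel] at h1
    rw [dist_eq_norm]
    linarith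

/-- Each property of the deterministic `h` is read off at a single `ω` where the few limits involved
exist. A common null set is needed only for a countable dense set of directions. -/
theorem exists_ae_hasLimitSupport {n : ℕ} {Ω : Type*} [MeasurableSpace Ω] {P : Measure Ω}
    [IsProbabilityMeasure P] {τ : ℤ → Ω → Ω} {a : EuclideanSpace ℝ (Fin n) → ℝ → Ω → ℝ} {α β : ℝ}
    (hτ : IsErgodicGroup P τ) (ha : IsRandomSpeed τ a α β) :
    ∃ h : EuclideanSpace ℝ (Fin n) → ℝ, IsSupportFunction h β ∧
      ∀ᵐ ω ∂P, HasLimitSupport (fun x r => a x r ω) h := by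
  choose h hh using exists_ae_tendsto_displacementSupport hτ ha
  have hsupp : IsSupportFunction h β := by
    refine ⟨fun p q => ?_, fun c p hc => ?_, fun p => ?_, fun p => ?_⟩
    · obtain ⟨ω, h1, h2, h3⟩ := ((hh (p + q)).and ((hh p).and (hh q))).exists
      refine le_of_tendsto_of_tendsto' h1 (h2.add h3) fun M => ?_
      rw [← mul_add]
      gcongr
      exact displacementSupport_add_le (ha.isSpeed ω) M.cast_nonneg
    · obtain ⟨ω, h1, h2⟩ := ((hh (c • p)).and (hh p)).exists
      refine tendsto_nhds_unique h1 ((h2.const_mul c).congr fun M => ?_)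
      rw [displacementSupport_smul hc]
      ring
    · obtain ⟨ω, h1⟩ := (hh p).exists
      exact ge_of_tendsto' h1 fun M => mul_nonneg (by positivity)
        (displacementSupport_nonneg (ha.isSpeed ω) M.cast_nonneg)
    · obtain ⟨ω, h1⟩ := (hh p).exists
      refine le_of_tendsto' h1 fun M => ?_
      have h2 := displacementSupport_le_mul_norm (p := p) (ha.isSpeed ω) M.cast_nonneg
      have hβ := (ha.isSpeed ω).pos_upper.le
      rcases M.eq_zero_or_pos with rfl | hM
      · simpa using mul_nonneg hβ (norm_nonneg p)
      · have hM' : (0 : ℝ) < M := by exact_mod_cast hM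
        rw [inv_mul_le_iff₀ hM']
        linarith
  refine ⟨h, hsupp, ?_⟩
  obtain ⟨Q, hQc, hQ⟩ := TopologicalSpace.exists_countable_dense (EuclideanSpace ℝ (Fin n))
  filter_upwards [(ae_ball_iff hQc).2 fun q _ => hh q] with ω hω
  have hb := ha.isSpeed ω
  have hα := hb.pos
  have hβ := hb.pos_upper
  exact hasLimitSupport_of_tendsto hb (by positivity)
    (hasMemoryBound_of_periodic hb fun x l t => ha.periodic x l t ω) hsupp hQ hω

/-! ### The limit set -/

section LimitSet

variable {E : Type*} [NormedAddCommGroup E] [InnerProductSpace ℝ E] {b : E → ℝ → ℝ} {h : E → ℝ}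
  {α β C : ℝ}

/-- The intersection of the half spaces `⟪p, ·⟫ ≤ h p`. -/
def wulffShape (h : E → ℝ) : Set E := {y | ∀ p, inner ℝ p y ≤ h p}

theorem convex_wulffShape (h : E → ℝ) : Convex ℝ (wulffShape h) := by
  intro y hy z hz c c' hc hc' hcc p
  rw [inner_add_right, inner_smul_right, inner_smul_right]
  calc c * inner ℝ p y + c' * inner ℝ p z ≤ c * h p + c' * h p := by
        gcongr
        · exact hy p
        · exact hz p
    _ = h p := by rw [← add_mul, hcc, one_mul]

theorem IsSupportFunction.zero_mem_wulffShape (hh : IsSupportFunction h β) :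
    (0 : E) ∈ wulffShape h := fun p => by simpa using hh.nonneg p

theorem IsSupportFunction.norm_le (hh : IsSupportFunction h β) {d : E} (hd : d ∈ wulffShape h)
    (hβ : 0 ≤ β) : ‖d‖ ≤ β := by
  have h1 := (hd d).trans (hh.le d)
  rw [real_inner_self_eq_norm_mul_norm] at h1
  rcases (norm_nonneg d).eq_or_lt with h0 | h0
  · rwa [← h0]
  · exact le_of_mul_le_mul_right h1 h0

theorem isClosed_wulffShape (h : E → ℝ) : IsClosed (wulffShape h) := by
  have : wulffShape h = ⋂ p, {y | inner ℝ p y ≤ h p} := by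
    ext
    simp [wulffShape]
  rw [this]
  exact isClosed_iInter fun p => isClosed_le (by fun_prop) continuous_const

theorem IsSupportFunction.isCompact_wulffShape [ProperSpace E] (hh : IsSupportFunction h β)
    (hβ : 0 ≤ β) : IsCompact (wulffShape h) :=
  Metric.isCompact_of_isClosed_isBounded (isClosed_wulffShape h)
    (isBounded_iff_forall_norm_le.2 ⟨β, fun _ hd => hh.norm_le hd hβ⟩)

/-- Hahn–Banach: extend `c • p ↦ c * h p` from the line to a functional dominated by `h`, and
represent it by a vector. On negative multiples domination follows from `h ≥ 0`. -/
theorem IsSupportFunction.exists_mem_wulffShape_inner_eq [FiniteDimensional ℝ E]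
    (hh : IsSupportFunction h β) (p : E) : ∃ d ∈ wulffShape h, inner ℝ p d = h p := by
  have h0 : h 0 = 0 := by simpa using hh.smul 0 0 le_rfl
  rcases eq_or_ne p 0 with rfl | hp
  · exact ⟨0, hh.zero_mem_wulffShape, by simp [h0]⟩
  obtain ⟨g, hg1, hg2⟩ := exists_extension_of_le_sublinear
    (LinearPMap.mkSpanSingleton p (h p) hp) h (fun c hc x => hh.smul c x hc.le) hh.add_le (by
      rintro ⟨x, hx⟩
      obtain ⟨c, rfl⟩ := Submodule.mem_span_singleton.1 hx
      refine (LinearPMap.mkSpanSingleton'_apply p (h p) _ c hx).trans_le ?_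
      rw [smul_eq_mul]
      rcases le_total 0 c with hc | hc
      · exact (hh.smul c p hc).ge
      · exact (mul_nonpos_of_nonpos_of_nonneg hc (hh.nonneg p)).trans (hh.nonneg _))
  have : CompleteSpace E := FiniteDimensional.complete ℝ E
  have hgd : ∀ q, inner ℝ q ((InnerProductSpace.toDual ℝ E).symm g.toContinuousLinearMap) = g q :=
    fun q => by rw [real_inner_comm, InnerProductSpace.toDual_symm_apply]; rfl
  refine ⟨(InnerProductSpace.toDual ℝ E).symm g.toContinuousLinearMap, fun q => ?_, ?_⟩
  · rw [hgd]
    exact hg2 q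
  · rw [hgd]
    have := hg1 ⟨p, Submodule.mem_span_singleton_self p⟩
    rwa [LinearPMap.mkSpanSingleton_apply] at this

/-- With `d` the nearest point to `y`, the direction `y - d` is normal to the set at `d`, so `h (y -
d) ≤ ⟪y - d, d⟫`; test `hy` in that direction. -/
theorem IsSupportFunction.exists_mem_wulffShape_norm_sub_le [FiniteDimensional ℝ E]
    (hh : IsSupportFunction h β) {y : E} {ε : ℝ} (hε : 0 ≤ ε)
    (hy : ∀ p, inner ℝ p y ≤ h p + ε * ‖p‖) : ∃ d ∈ wulffShape h, ‖y - d‖ ≤ ε := by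
  have : CompleteSpace E := FiniteDimensional.complete ℝ E
  obtain ⟨d, hd, hmin⟩ := exists_norm_eq_iInf_of_complete_convex ⟨0, hh.zero_mem_wulffShape⟩
    (isClosed_wulffShape h).isComplete (convex_wulffShape h) y
  rw [norm_eq_iInf_iff_real_inner_le_zero (convex_wulffShape h) hd] at hmin
  refine ⟨d, hd, ?_⟩
  obtain ⟨d', hd', heq⟩ := hh.exists_mem_wulffShape_inner_eq (y - d)
  have h1 := hmin d' hd'
  have h2 := hy (y - d)
  have h3 := real_inner_self_eq_norm_mul_norm (y - d)
  rw [inner_sub_right] at h1 h3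
  rcases (norm_nonneg (y - d)).eq_or_lt with h0 | h0
  · rwa [← h0]
  · exact le_of_mul_le_mul_right (by linarith) h0

/-- If the support functions of the displacements on `m` consecutive intervals of length `δ` almost
dominate `δ • h`, then a path made of `m` pieces follows the ray in direction `d` up to an error of
order `√m`. -/
theorem exists_mem_reach_norm_sub_sq_le (hb : IsSpeed b α β) (hC : HasMemoryBound b C)
    (hC0 : 0 ≤ C) {δ η : ℝ} (hδ : 0 < δ) (hη : 0 ≤ η) {m : ℕ} {d : E} (hd : d ∈ wulffShape h)
    (hdβ : ‖d‖ ≤ β) (hsupp : ∀ k < m, ∀ p,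
      δ * h p - η * ‖p‖ ≤ displacementSupport b (k * δ) ((k + 1) * δ) p) (x : E) :
    ∀ k ≤ m, ∃ v, x + v ∈ reach b 0 (k * δ) x ∧
      ‖v - (k * δ) • d‖ ^ 2 ≤ k * (4 * β * (m * δ) * (η + C) + 6 * β ^ 2 * δ ^ 2) := by
  have hβ := hb.pos_upper
  intro k
  induction k with
  | zero =>
    intro _
    exact ⟨0, by simpa using self_mem_reach hb le_rfl, by simp⟩
  | succ k ih =>
    intro hk
    obtain ⟨v, hv, hvS⟩ := ih (by omega)
    have hk0 : (0 : ℝ) ≤ k * δ := by positivity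
    have hkk : (k : ℝ) * δ ≤ (k + 1) * δ := by gcongr; linarith
    have hkm : (k : ℝ) * δ ≤ m * δ := by
      gcongr
      omega
    set S := v - (k * δ) • d with hS
    have hSn : ‖S‖ ≤ 2 * β * (m * δ) := by
      have h1 : ‖v‖ ≤ β * (k * δ) := by
        simpa using norm_sub_le_of_mem_reach hb hk0 hv
      have h2 : ‖(k * δ : ℝ) • d‖ ≤ (k * δ) * β := by
        rw [norm_smul, Real.norm_of_nonneg hk0]
        gcongr
      calc ‖S‖ ≤ ‖v‖ + ‖(k * δ : ℝ) • d‖ := norm_sub_le _ _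
        _ ≤ 2 * β * (k * δ) := by linarith
        _ ≤ _ := by gcongr
    -- Steer against the current error `S`. The near-maximality defect `β ^ 2 * δ ^ 2` is of the
    -- same order as `‖u‖ ^ 2`.
    obtain ⟨w, hw, hwS⟩ := exists_lt_inner_of_lt_displacementSupport hb hkk
      (sub_lt_self (displacementSupport b (k * δ) ((k + 1) * δ) (-S))
        (by positivity : 0 < β ^ 2 * δ ^ 2))
    obtain ⟨w', hw', hww⟩ := hC.inner_le hkk hw (x + v) (-S)
    have h1 := hsupp k (by omega) (-S)
    have h2 := hd (-S)
    set u := w' - δ • d with hu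
    have hun : ‖u‖ ≤ 2 * β * δ := by
      have h3 := norm_sub_le_of_mem_reach hb hkk hw'
      rw [add_sub_cancel_left] at h3
      have h4 : ‖δ • d‖ ≤ δ * β := by
        rw [norm_smul, Real.norm_of_nonneg hδ.le]
        gcongr
      calc ‖u‖ ≤ ‖w'‖ + ‖δ • d‖ := norm_sub_le _ _
        _ ≤ 2 * β * δ := by linarith
    have hun2 : ‖u‖ ^ 2 ≤ 4 * β ^ 2 * δ ^ 2 := by
      calc ‖u‖ ^ 2 ≤ (2 * β * δ) ^ 2 := by gcongr
        _ = _ := by ring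
    -- The cross term in `‖S + u‖ ^ 2` has no contribution of order `δ * ‖S‖` beyond `η`: the gain
    -- is at least `δ * h (-S)` up to errors, and `⟪-S, d⟫ ≤ h (-S)`.
    have h3 : inner ℝ S u ≤ (η + C) * ‖S‖ + β ^ 2 * δ ^ 2 := by
      have h4 : inner ℝ S u = -(inner ℝ (-S) w') + δ * inner ℝ (-S) d := by
        rw [hu, inner_sub_right, inner_smul_right, inner_neg_left, inner_neg_left]
        ring
      have h5 : δ * inner ℝ (-S) d ≤ δ * h (-S) := by gcongr
      rw [norm_neg] at hww h1
      rw [h4]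
      linarith
    refine ⟨v + w', ?_, ?_⟩
    · push_cast
      rw [← add_assoc]
      exact reach_trans hb hk0 hkk hv hw'
    · have h4 : v + w' - (((k + 1 : ℕ) : ℝ) * δ) • d = S + u := by
        rw [hS, hu]
        push_cast
        rw [add_mul, one_mul, add_smul]
        abel
      rw [h4, norm_add_sq_real]
      have h5 : (η + C) * ‖S‖ ≤ (η + C) * (2 * β * (m * δ)) := by gcongr
      push_cast
      linarith

/-- The displacements on `[0, T]` from any starting point are uniformly close to `T • D`, where `D`
is the convex set with support function `h`. -/
theorem HasLimitSupport.eventually_close [FiniteDimensional ℝ E] (hlim : HasLimitSupport b h)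
    (hb : IsSpeed b α β) (hC : HasMemoryBound b C) (hC0 : 0 ≤ C) (hh : IsSupportFunction h β)
    {η : ℝ} (hη : 0 < η) :
    ∀ᶠ T : ℝ in atTop,
      (∀ v ∈ displacements b 0 T, ∃ d ∈ wulffShape h, ‖v - T • d‖ ≤ η * T) ∧
      ∀ x, ∀ d ∈ wulffShape h, ∃ v, x + v ∈ reach b 0 T x ∧ ‖v - T • d‖ ≤ η * T := by
  have hβ := hb.pos_upper
  refine Eventually.and ?_ ?_
  · obtain ⟨T₀, hT₀, hT⟩ := hlim η hη
    filter_upwards [eventually_ge_atTop T₀] with T hTT v hv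
    have hT0 : 0 < T := hT₀.trans_le hTT
    obtain ⟨d, hd, hvd⟩ := hh.exists_mem_wulffShape_norm_sub_le (y := T⁻¹ • v) hη.le fun p => by
      have h1 := (abs_le.1 (hT T hTT p)).2
      have h2 := inner_le_displacementSupport hb hT0.le p hv
      rw [inner_smul_right, inv_mul_le_iff₀ hT0]
      linarith
    refine ⟨d, hd, ?_⟩
    have : v - T • d = T • (T⁻¹ • v - d) := by
      rw [smul_sub, smul_inv_smul₀ hT0.ne']
    rw [this, norm_smul, Real.norm_of_nonneg hT0.le, mul_comm]
    gcongr
  -- The final squared error has three terms: the choice of `m`, that of `ε`, and `T ≥ 12 * β * m *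
  -- C / η ^ 2` each keep one below `η ^ 2 * T ^ 2 / 3`.
  · obtain ⟨m, hm⟩ := exists_nat_gt (18 * β ^ 2 / η ^ 2)
    have hm0 : (0 : ℝ) < m := lt_of_le_of_lt (by positivity) hm
    have hm0' : 0 < m := by exact_mod_cast hm0
    rw [div_lt_iff₀ (by positivity)] at hm
    set ε := η ^ 2 / (24 * β * m) with hε
    have hε0 : 0 < ε := by positivity
    obtain ⟨T₀, hT₀, hT⟩ := hlim ε hε0
    filter_upwards [eventually_ge_atTop (β * T₀ / ε), eventually_ge_atTop (12 * β * m * C / η ^ 2),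
      eventually_gt_atTop 0] with T hT1 hT2 hT0 x d hd
    rw [div_le_iff₀ hε0] at hT1
    rw [div_le_iff₀ (by positivity)] at hT2
    -- The error is measured against `T` rather than `r`, so times `r < T₀` are covered by the
    -- trivial bound `β * T₀ ≤ ε * T`. Differences of two such estimates control each piece.
    have herr : ∀ r, 0 ≤ r → r ≤ T → ∀ p,
        |displacementSupport b 0 r p - r * h p| ≤ ε * T * ‖p‖ := by
      intro r hr0 hrT p
      rcases le_total T₀ r with hr | hr
      · refine (hT r hr p).trans ?_
        gcongr
      · have h1 := displacementSupport_nonneg (p := p) hb hr0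
        have h2 := displacementSupport_le_mul_norm (p := p) hb hr0
        have h3 : r * h p ≤ r * (β * ‖p‖) := by gcongr; exact hh.le p
        have h4 : 0 ≤ r * h p := mul_nonneg hr0 (hh.nonneg p)
        have h5 : β * r * ‖p‖ ≤ ε * T * ‖p‖ := by
          refine mul_le_mul_of_nonneg_right ?_ (norm_nonneg p)
          calc β * r ≤ β * T₀ := by gcongr
            _ ≤ ε * T := by linarith
        rw [abs_le]
        constructor <;> linarith
    have hδ : 0 < T / m := by positivity
    have hmδ : m * (T / m) = T := by field_simp
    have hsupp : ∀ k < m, ∀ p, (T / m) * h p - (2 * ε * T) * ‖p‖ ≤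
        displacementSupport b (k * (T / m)) ((k + 1) * (T / m)) p := by
      intro k hk p
      have hk0 : (0 : ℝ) ≤ k * (T / m) := by positivity
      have hkk : (k : ℝ) * (T / m) ≤ (k + 1) * (T / m) := by gcongr; linarith
      have hkT : ((k : ℝ) + 1) * (T / m) ≤ T := by
        calc ((k : ℝ) + 1) * (T / m) ≤ m * (T / m) := by
              gcongr
              exact_mod_cast hk
          _ = T := hmδ
      have h1 := displacementSupport_le_add (p := p) hb hk0 hkk
      have h2 := abs_le.1 (herr _ hk0 (hkk.trans hkT) p)
      have h3 := abs_le.1 (herr _ (hk0.trans hkk) hkT p)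
      linarith
    obtain ⟨v, hv, hvn⟩ := exists_mem_reach_norm_sub_sq_le hb hC hC0 hδ (by positivity) hd
      (hh.norm_le hd hβ.le) hsupp x m le_rfl
    rw [hmδ] at hv hvn
    refine ⟨v, hv, ?_⟩
    refine le_of_sq_le_sq (hvn.trans ?_) (by positivity)
    have e1 : (m : ℝ) * (4 * β * T * (2 * ε * T + C) + 6 * β ^ 2 * (T / m) ^ 2) =
        η ^ 2 * T ^ 2 / 3 + 4 * β * m * C * T + 6 * β ^ 2 / m * T ^ 2 := by
      rw [hε]
      field_simp
      ring
    have e2 : 4 * β * m * C * T ≤ η ^ 2 * T ^ 2 / 3 := by nlinarith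
    have e3 : 6 * β ^ 2 / m ≤ η ^ 2 / 3 := by
      rw [div_le_iff₀ hm0]
      linarith
    have e4 : 6 * β ^ 2 / m * T ^ 2 ≤ η ^ 2 / 3 * T ^ 2 := by gcongr
    rw [e1]
    linarith

theorem HasLimitSupport.tendsto_iSup_hausdorffEDist [FiniteDimensional ℝ E]
    (hlim : HasLimitSupport b h) (hb : IsSpeed b α β) (hC : HasMemoryBound b C) (hC0 : 0 ≤ C)
    (hh : IsSupportFunction h β) {K : Set E} (hK : Bornology.IsBounded K) :
    Tendsto (fun t : ℝ => ⨆ x ∈ K, Metric.hausdorffEDist (t⁻¹ • reach b 0 t x) (wulffShape h))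
      atTop (𝓝 0) := by
  obtain ⟨R, hR⟩ := isBounded_iff_forall_norm_le.1 hK
  rw [ENNReal.tendsto_nhds_zero]
  intro ε hε
  obtain ⟨r, hr0, hrε⟩ := ENNReal.lt_iff_exists_nnreal_btwn.1 hε
  have hr0' : (0 : ℝ) < r := by exact_mod_cast hr0
  filter_upwards [hlim.eventually_close hb hC hC0 hh (half_pos hr0'),
    eventually_ge_atTop (2 * |R| / r), eventually_gt_atTop 0] with t ht ht1 ht0
  rw [div_le_iff₀ hr0'] at ht1
  refine iSup₂_le fun x hx => le_trans ?_ hrε.le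
  -- Half of `r` pays for the displacement, the other half for the starting point, since `‖x‖ ≤ r /
  -- 2 * t`.
  have hdist : ∀ v d, ‖v - t • d‖ ≤ r / 2 * t → edist (t⁻¹ • (x + v)) d ≤ r := by
    intro v d hvd
    rw [edist_nndist, ENNReal.coe_le_coe, ← NNReal.coe_le_coe, coe_nndist, dist_eq_norm]
    have e : t⁻¹ • (x + v) - d = t⁻¹ • (x + (v - t • d)) := by
      rw [smul_add, smul_add, smul_sub, inv_smul_smul₀ ht0.ne', add_sub_assoc]
    rw [e, norm_smul, norm_inv, Real.norm_of_nonneg ht0.le, inv_mul_le_iff₀ ht0]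
    have h1 : ‖x‖ ≤ |R| := (hR x hx).trans (le_abs_self R)
    linarith [norm_add_le x (v - t • d)]
  refine Metric.hausdorffEDist_le_of_mem_edist ?_ ?_
  · rintro _ ⟨y, hy, rfl⟩
    obtain ⟨d, hd, hyd⟩ := ht.1 (y - x) ⟨x, by simpa using hy⟩
    exact ⟨d, hd, by simpa using hdist (y - x) d hyd⟩
  · intro d hd
    obtain ⟨v, hv, hvd⟩ := ht.2 x d hd
    exact ⟨t⁻¹ • (x + v), Set.smul_mem_smul_set hv, by rw [edist_comm]; exact hdist v d hvd⟩

end LimitSet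

theorem mainTheorem1 {n : ℕ} {Ω : Type*} [MeasurableSpace Ω] (P : Measure Ω)
    [IsProbabilityMeasure P] (τ : ℤ → Ω → Ω) (hτ : IsErgodicGroup P τ)
    (a : EuclideanSpace ℝ (Fin n) → ℝ → Ω → ℝ) (ha : VelocityAssumption τ a) :
    ∃ D : Set (EuclideanSpace ℝ (Fin n)), D.Nonempty ∧ IsCompact D ∧ Convex ℝ D ∧
      ∃ Ω' : Set Ω, MeasurableSet Ω' ∧ P Ω' = 1 ∧ ∀ ω ∈ Ω',
        (∀ x ∈ unitCell n,
          (∀ t : ℝ, 0 < t → (reachableSet a ω t x).Nonempty ∧ IsCompact (reachableSet a ω t x)) ∧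
          Tendsto (fun t : ℝ => Metric.hausdorffEDist (t⁻¹ • reachableSet a ω t x) D)
            atTop (𝓝 0)) ∧
        Tendsto
          (fun t : ℝ => ⨆ x ∈ unitCell n, Metric.hausdorffEDist (t⁻¹ • reachableSet a ω t x) D)
          atTop (𝓝 0) := by
  obtain ⟨α, β, hs⟩ := ha.exists_isRandomSpeed hτ
  obtain ⟨h, hh, hae⟩ := exists_ae_hasLimitSupport hτ hs
  obtain ⟨ω₀, -⟩ := hae.exists
  have hβ := (hs.isSpeed ω₀).pos_upper
  have hα := (hs.isSpeed ω₀).pos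
  -- The event is the complement of a measurable null set containing all exceptional `ω`, so
  -- measurability of `HasLimitSupport` in `ω` is not needed.
  obtain ⟨Ω', hsub, hmeas, hnull⟩ := exists_measurable_superset_of_null (ae_iff.1 hae)
  refine ⟨wulffShape h, ⟨0, hh.zero_mem_wulffShape⟩, hh.isCompact_wulffShape hβ.le,
    convex_wulffShape h, Ω'ᶜ, hmeas.compl, (prob_compl_eq_one_iff hmeas).2 hnull, fun ω hω => ?_⟩
  have hlim : HasLimitSupport (fun x r => a x r ω) h := by
    by_contra hcon
    exact hω (hsub hcon)
  have hb := hs.isSpeed ω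
  have heq : ∀ t x, 0 ≤ t → reachableSet a ω t x = reach (fun x r => a x r ω) 0 t x :=
    fun t x ht => reachableSetFrom_eq_reach hb ht x
  have hmain : Tendsto
      (fun t : ℝ => ⨆ x ∈ unitCell n,
        Metric.hausdorffEDist (t⁻¹ • reachableSet a ω t x) (wulffShape h)) atTop (𝓝 0) := by
    refine (hlim.tendsto_iSup_hausdorffEDist hb
      (hasMemoryBound_of_periodic hb fun x l t => hs.periodic x l t ω) (by positivity) hh
      (isCompact_unitCell n).isBounded).congr' ?_
    filter_upwards [eventually_ge_atTop 0] with t ht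
    simp only [heq t _ ht]
  refine ⟨fun x hx => ⟨fun t ht => ?_, ?_⟩, hmain⟩
  · obtain ⟨L, hL0, hL⟩ := hs.lipschitz ω
    rw [heq t x ht.le]
    exact ⟨⟨x, self_mem_reach hb ht.le⟩, isCompact_reach hb hL0 hL ht.le x⟩
  · exact tendsto_of_tendsto_of_tendsto_of_le_of_le tendsto_const_nhds hmain (fun _ => zero_le)
      fun t => le_iSup₂ (f := fun x (_ : x ∈ unitCell n) =>
        Metric.hausdorffEDist (t⁻¹ • reachableSet a ω t x) (wulffShape h)) x hx
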